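/- **Setting.** An instance is a tuple $X=(X_1,\dots,X_n)$, $n\ge 1$, of independent non-negative real random variables with finite expectation and known laws; write $M=\max_i X_i$ and $\mathrm{OPT}(X)=\mathbb{E}[M]$. The instance is *continuous* if no $X_i$ has a point mass. For a realization $v=(v_1,\dots,v_n)$ and $\zeta\in\mathbb{R}$, let $\mathrm{TAL}(v,\zeta)=v_i$ for the least index $i$ with $v_i\ge\zeta$, and $\mathrm{TAL}(v,\zeta)=0$ if there is no such index. For $\alpha\in[0,1]$ and $\tau\ge 0$ put $$\mathrm{TAL}_\alpha(X,\tau)=\mathbb{E}_{v\sim X}\Big[\mathrm{TAL}\big(v,\max\{\tau,\ \alpha\max_i v_i\}\big)\Big].$$ A *base threshold* of $X$ is a real $\bar\tau=T_X(3/4)\ge 0$ with $\mathbb{E}\big[M\cdot\mathbf 1[M\ge\bar\tau]\big]=\tfrac34\,\mathrm{OPT}(X)$; it does not depend on $\alpha$. **Theorem 4.2.** Every continuous instance has a base threshold, and for any instance $X$ and any $\alpha\in[0,1]$ the value $\mathrm{TAL}_\alpha(X,\bar\tau)$ is the same for all base thresholds $\bar\tau$ of $X$. Let $$f(\alpha)=\inf_X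 \frac{\mathrm{TAL}_\alpha(X,\bar\tau)}{\mathrm{OPT}(X)},$$ where $X$ ranges over the continuous instances and $\bar\tau$ is a base threshold of $X$. Then for every $\alpha\in[0,1]$ $$\frac12+\frac{\alpha^3}{4}\ \le\ f(\alpha)\ \le\ \frac12+\frac{\alpha}{4},$$ and in particular $f(0)=\tfrac12$ and $f(1)=\tfrac34$. Moreover, for every $\alpha\in[0,1]$ and every instance $X$, continuous or not, that has a base threshold $\bar\tau$, $$\mathrm{TAL}_\alpha(X,\bar\tau)\ \ge\ \Big(\frac12+\frac{\alpha^3}{4}\Big)\,\mathrm{OPT}(X).$$ -/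

import Mathlib

open MeasureTheory

noncomputable section

/-- A prophet-inequality instance `X = (X₁, …, Xₙ)`, `n ≥ 1`: independent non-negative real random
variables with finite expectation, given by their laws. -/
structure ProphetInstance where
  n : ℕ
  n_pos : 0 < n
  law : Fin n → Measure ℝ
  isProb : ∀ i, IsProbabilityMeasure (law i)
  nonneg : ∀ i, ∀ᵐ x ∂(law i), 0 ≤ x
  integrable : ∀ i, Integrable (fun x : ℝ => x) (law i)

attribute [instance] ProphetInstance.isProb

/-- The maximum `m(R)` of a realization `R = (v₁, …, vₙ)`. -/
def maxVal {n : ℕ} (v : Fin n → ℝ) : ℝ := ⨆ i, v i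

open Classical in
/-- The value collected from the realization `v` by the algorithm that accepts the first entry
that is at least `ζ`; it is `0` if there is no such entry. -/
def thresholdVal {n : ℕ} (v : Fin n → ℝ) (ζ : ℝ) : ℝ :=
  if h : (Finset.univ.filter fun i => ζ ≤ v i).Nonempty then
    v ((Finset.univ.filter fun i => ζ ≤ v i).min' h)
  else 0

namespace ProphetInstance

/-- The joint law of the realization `R ∼ X`; the coordinates are independent. -/
def joint (X : ProphetInstance) : Measure (Fin X.n → ℝ) := Measure.pi X.law

/-- `OPT = E[M]`, the expected maximum. -/
def opt (X : ProphetInstance) : ℝ := ∫ v, maxVal v ∂X.joint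

/-- The variables are continuous: no law has a point mass. -/
def IsContinuous (X : ProphetInstance) : Prop := ∀ i (x : ℝ), X.law i {x} = 0

/-- `τ ≥ 0` satisfies the equation `E[M · 1[M ≥ τ]] = c · OPT` that defines `T_X(c)`. -/
def IsBaseThreshold (X : ProphetInstance) (c τ : ℝ) : Prop :=
  0 ≤ τ ∧ ∫ v in {v | τ ≤ maxVal v}, maxVal v ∂X.joint = c * X.opt

/-- `TAL_α(X, τ)`: the expected value obtained with the effective threshold
`max {τ, α · m(R)}`. -/
def tal (X : ProphetInstance) (α τ : ℝ) : ℝ :=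
  ∫ v, thresholdVal v (max τ (α * maxVal v)) ∂X.joint

end ProphetInstance

/-- The competitive ratio `f(α) = inf_X TAL_α(X, τ̄) / OPT(X)`, where `X` ranges over the instances
with continuous variables (so that `OPT(X) > 0`) and `τ̄ = T_X(3/4)`. The base threshold `τ̄` does
not depend on `α`. -/
def obliviousRatio (α : ℝ) : ℝ :=
  sInf {r : ℝ | ∃ (X : ProphetInstance) (τ : ℝ),
    X.IsContinuous ∧ X.IsBaseThreshold (3 / 4) τ ∧ r = X.tal α τ / X.opt}

end

/-! Lower bound. Put `p = P(M ≥ τ)` and `b = E[(M - τ)⁺] / τ`; the base-threshold equation then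
reads `OPT = (4/3) τ (b + p)`. When `M ≥ τ`, the algorithm collects at least the effective threshold
`max τ (α M)`, and if only one entry reaches `τ` it also gains the excess `M - max τ (α M)`
(`thresholdVal_ge`). On `M ≥ τ` this excess is `(1 - α)(M - τ)` plus a bounded part `clip`, whose
mean is written `(1 - α) τ e`. Independence bounds the solo gains from below: a union bound handles
the linear part, and a logarithmic estimate handles the clipped part and supplies an extra `e² / 2`
(`sum_excess_ge`). Altogether `TAL / τ ≥ (b + p) - (1 - α) (p b + p e - (1 - p) e² / 2)`. Since `1 -
α³ = (1 - α)(1 + α + α²)`, the guarantee for `α < 1` becomes the polynomial inequality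
`loss_real_ineq`, under three constraints: `e ≤ p`, `(1 - α) e ≤ α b`, and `b + p ≤ 3 (1 - p)`. The
last holds because the quarter of `OPT` lying below `τ` is at most `(1 - p) τ`.

Upper bound. For `0 < α < 1` take a first value near `1` and a second value near `0` or, with
probability `α / (1 + α)`, near `1 / α`. Even a large second value does not push `α M` above the
first, so the first is accepted whenever it reaches `τ`, which happens with probability at most
about `1/2` (`pair_tal_mul_le`). At `α = 0` the bound follows from monotonicity, `TAL_0 ≤ TAL_α`; at
`α = 1` from `TAL ≤ E[M · 1[M ≥ τ]]`. -/

/-! ### The polynomial inequality behind the guarantee. -/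

/-- With `E = a (3 - 4 p) / (1 - a)` this says `E ≤ p / (1 - p)`: the concave quadratic `p e - (1 -
p) e² / 2` is still increasing up to `E`. -/
theorem loss_slope_ineq {a p : ℝ} (hp13 : 1 / 3 < p) (hp34 : p ≤ 3 / 4)
    (hcase : a + a ^ 2 < 3 * p - 1 - p ^ 2 / 2) :
    a * (3 - 4 * p) * (1 - p) ≤ p * (1 - a) := by
  -- Tangent lines to `a²` at `1/4` and to `p²` at `3/5` linearize `hcase`.
  have h1 : a ≤ 8 / 5 * p - 1 / 2 := by
    nlinarith [sq_nonneg (a - 1 / 4), sq_nonneg (p - 3 / 5)]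
  have h2 : 0 ≤ 3 - 6 * p + 4 * p ^ 2 := by nlinarith [sq_nonneg (4 * p - 3)]
  have h3 := mul_le_mul_of_nonneg_right h1 h2
  -- The chord of the convex left side over `[1/3, 3/4]`.
  have h4 : 3 - 6 * p + 4 * p ^ 2 ≤ 2 - 5 / 3 * p := by
    nlinarith [mul_nonneg (sub_nonneg.2 hp13.le) (sub_nonneg.2 hp34)]
  have h5 := mul_le_mul_of_nonneg_left h4 (by linarith : (0 : ℝ) ≤ 8 / 5 * p - 1 / 2)
  have h6 : (8 / 5 * p - 1 / 2) * (2 - 5 / 3 * p) ≤ p := by nlinarith [sq_nonneg (p - 1 / 2)]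
  linarith

/-- The case `b = 3 - 4 p`, `e = E` of the loss bound, with denominators cleared. Rearranged, it is
`(1 - p) a² (2 a (1 - a) - (3 - 4 p)²) ≤ 2 (1 - a) (2 p - 1)²`, and `2 a (1 - a) ≤ 1/2`. -/
theorem loss_quadratic_ineq {a p : ℝ} (ha0 : 0 ≤ a) (ha1 : a < 1) (hp13 : 1 / 3 < p)
    (hp34 : p ≤ 3 / 4) (hcase : a + a ^ 2 < 3 * p - 1 - p ^ 2 / 2) :
    2 * (1 - a) * (a ^ 3 * (1 - p) - (2 * p - 1) ^ 2) ≤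
      (1 - p) * a ^ 2 * (3 - 4 * p) ^ 2 := by
  -- On a short range of `p`, constants suffice: `c` and `r` bound the two squares below, `m` bounds
  -- `a` above, and `d` bounds `1/2 - c` above.
  have hred : ∀ c d m r : ℝ, 0 ≤ m → c ≤ (3 - 4 * p) ^ 2 → 1 / 2 - c ≤ d → 0 ≤ d → a ≤ m →
      r ≤ (2 * p - 1) ^ 2 → (1 - p) * m ^ 2 * d ≤ 2 * (1 - m) * r → 0 ≤ r →
      2 * (1 - a) * (a ^ 3 * (1 - p) - (2 * p - 1) ^ 2) ≤
        (1 - p) * a ^ 2 * (3 - 4 * p) ^ 2 := by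
    intro c d m r hm hc hd hd0 ham hr hmr hr0
    have h1 : 2 * a * (1 - a) - (3 - 4 * p) ^ 2 ≤ d := by nlinarith [sq_nonneg (2 * a - 1)]
    have h2 : (1 - p) * a ^ 2 * (2 * a * (1 - a) - (3 - 4 * p) ^ 2) ≤ (1 - p) * a ^ 2 * d :=
      mul_le_mul_of_nonneg_left h1 (mul_nonneg (by linarith) (sq_nonneg a))
    have h3 : (1 - p) * a ^ 2 * d ≤ (1 - p) * m ^ 2 * d := by
      have : 0 ≤ 1 - p := by linarith
      gcongr
    have h4 : 2 * (1 - m) * r ≤ 2 * (1 - a) * r := by nlinarith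
    have h5 : 2 * (1 - a) * r ≤ 2 * (1 - a) * (2 * p - 1) ^ 2 :=
      mul_le_mul_of_nonneg_left hr (by linarith)
    nlinarith
  have ham : ∀ m : ℝ, 0 ≤ m → 3 * p - 1 - p ^ 2 / 2 ≤ m + m ^ 2 → a ≤ m := by
    intro m hm h
    by_contra! h'
    nlinarith
  -- On the first range `(3 - 4 p)² ≥ 1/2`, so `d = 0`. On the later ones `c` comes from the right
  -- endpoint and `r` from the left, with `m` chosen so that `m + m²` exceeds the bound in `hcase`.
  rcases le_or_gt p (57 / 100) with h1 | h1
  · exact hred (1 / 2) 0 1 0 zero_le_one (by nlinarith) (by norm_num) le_rfl ha1.le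
      (sq_nonneg _) (by norm_num) le_rfl
  rcases le_or_gt p (3 / 5) with h2 | h2
  · exact hred (36 / 100) (14 / 100) (44 / 100) (196 / 10000) (by norm_num) (by nlinarith)
      (by norm_num) (by norm_num) (ham _ (by norm_num) (by nlinarith)) (by nlinarith)
      (by nlinarith) (by norm_num)
  rcases le_or_gt p (65 / 100) with h3 | h3
  · exact hred (16 / 100) (34 / 100) (1 / 2) (4 / 100) (by norm_num) (by nlinarith)
      (by norm_num) (by norm_num) (ham _ (by norm_num) (by nlinarith)) (by nlinarith)
      (by nlinarith) (by norm_num)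
  · exact hred 0 (1 / 2) (61 / 100) (9 / 100) (by norm_num) (sq_nonneg _)
      (by norm_num) (by norm_num) (ham _ (by norm_num) (by nlinarith)) (by nlinarith)
      (by nlinarith) (by norm_num)

/-- If `p ≤ s` the two products are bounded termwise. Otherwise the worst `b` is the largest one, `3
- 4 p`; then the left side increases in `e` up to `p / (1 - p)`, and `e` is replaced by whichever of
its bounds `p` and `a (3 - 4 p) / (1 - a)` suffices. -/
theorem loss_real_ineq {a p b e : ℝ} (ha0 : 0 ≤ a) (ha1 : a < 1) (hp0 : 0 ≤ p) (hp1 : p < 1)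
    (hb : 0 ≤ b) (he0 : 0 ≤ e) (hep : e ≤ p) (heb : (1 - a) * e ≤ a * b)
    (hbp : b + p ≤ 3 * (1 - p)) :
    p * b + p * e - (1 - p) * e ^ 2 / 2 ≤ (1 + a + a ^ 2) / 3 * (b + p) := by
  set s := (1 + a + a ^ 2) / 3 with hs
  have hs0 : 0 ≤ s := by positivity
  rcases le_or_gt p s with hps | hps
  · nlinarith [mul_nonneg (sub_nonneg.2 hp1.le) (sq_nonneg e), mul_le_mul hps hep he0 hs0,
      mul_le_mul_of_nonneg_right hps hb]
  have hp34 : p ≤ 3 / 4 := by linarith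
  have h3 : 0 ≤ 3 - 4 * p := by linarith
  have hb' : b ≤ 3 - 4 * p := by linarith
  have heb' : (1 - a) * e ≤ a * (3 - 4 * p) := heb.trans (mul_le_mul_of_nonneg_left hb' ha0)
  have hmono : (p - s) * b ≤ (p - s) * (3 - 4 * p) :=
    mul_le_mul_of_nonneg_left hb' (sub_nonneg.2 hps.le)
  suffices h : (p - s) * (3 - 4 * p) + p * e - (1 - p) * e ^ 2 / 2 ≤ s * p by nlinarith
  have hk : 1 + a + a ^ 2 < 3 * p := by rw [hs] at hps; linarith
  have hp13 : 1 / 3 < p := by nlinarith [sq_nonneg a]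
  -- the bound from `e ≤ p`
  have hA : 3 * p - 1 - p ^ 2 / 2 ≤ a + a ^ 2 →
      (p - s) * (3 - 4 * p) + p * e - (1 - p) * e ^ 2 / 2 ≤ s * p := by
    intro h
    have h1 : p * e - (1 - p) * e ^ 2 / 2 ≤ p ^ 2 - (1 - p) * p ^ 2 / 2 := by
      have : 0 ≤ (p - e) * (p - (1 - p) * (p + e) / 2) := by
        apply mul_nonneg (by linarith)
        nlinarith
      nlinarith
    -- At `e = p` the slack in the goal is exactly this product.
    have h2 : 0 ≤ (1 - p) * (a + a ^ 2 - (3 * p - 1 - p ^ 2 / 2)) :=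
      mul_nonneg (by linarith) (by linarith)
    rw [hs]; nlinarith
  by_cases hcase : 3 * p - 1 - p ^ 2 / 2 ≤ a + a ^ 2
  · exact hA hcase
  push Not at hcase
  clear hA
  -- the bound from `e ≤ a (3 - 4 p) / (1 - a)`
  have ha1' : 0 < 1 - a := by linarith
  have hc := loss_slope_ineq hp13 hp34 hcase
  have hkey := loss_quadratic_ineq ha0 ha1 hp13 hp34 hcase
  obtain ⟨E, hE⟩ : ∃ E : ℝ, (1 - a) * E = a * (3 - 4 * p) :=
    ⟨a * (3 - 4 * p) / (1 - a), mul_div_cancel₀ _ ha1'.ne'⟩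
  have heE : e ≤ E := le_of_mul_le_mul_left (heb'.trans_eq hE.symm) ha1'
  have hEp : (1 - p) * E ≤ p := by
    refine le_of_mul_le_mul_left (?_ : (1 - a) * ((1 - p) * E) ≤ (1 - a) * p) ha1'
    nlinarith
  have h1 : p * e - (1 - p) * e ^ 2 / 2 ≤ p * E - (1 - p) * E ^ 2 / 2 := by
    have : 0 ≤ (E - e) * (p - (1 - p) * (e + E) / 2) := by
      apply mul_nonneg (by linarith)
      nlinarith
    nlinarith
  have h2 : (p - s) * (3 - 4 * p) + p * E - (1 - p) * E ^ 2 / 2 ≤ s * p := by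
    refine le_of_mul_le_mul_left
      (?_ : (1 - a) ^ 2 * _ ≤ (1 - a) ^ 2 * _) (pow_pos ha1' 2)
    have h3 : (1 - a) ^ 2 * E ^ 2 = a ^ 2 * (3 - 4 * p) ^ 2 := by rw [← mul_pow, hE, mul_pow]
    have h4 : (1 - a) ^ 2 * E = (1 - a) * (a * (3 - 4 * p)) := by rw [← hE]; ring
    have h5 : (1 - a) ^ 2 * ((p - s) * (3 - 4 * p) + p * E - (1 - p) * E ^ 2 / 2 - s * p) =
        (1 - a) * (a ^ 3 * (1 - p) - (2 * p - 1) ^ 2) - (1 - p) / 2 * (a ^ 2 * (3 - 4 * p) ^ 2) := by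
      rw [← h3, hs]
      linear_combination p * h4
    linarith
  linarith

/-! ### A logarithmic estimate for exactly-one events. -/

theorem add_sq_half_le_neg_log {e : ℝ} (h0 : 0 ≤ e) (h1 : e < 1) :
    e + e ^ 2 / 2 ≤ -Real.log (1 - e) := by
  have h := Real.hasSum_pow_div_log_of_abs_lt_one (abs_lt.2 ⟨by linarith, h1⟩)
  have := sum_le_hasSum (Finset.range 2) (fun i _ => by positivity) h
  norm_num [Finset.sum_range_succ] at this
  linarith

/-- Dividing by `∏ F i` leaves `∑ x i / F i ≥ ∑ x i / (1 - x i) ≥ -∑ log (1 - x i) ≥ -log (1 - e)`.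
-/
theorem sum_mul_prod_erase_ge {ι : Type*} [Fintype ι] [DecidableEq ι] {F x : ι → ℝ} {e : ℝ}
    (hF : ∀ i, 0 < F i) (hx0 : ∀ i, 0 ≤ x i) (hx1 : ∀ i, x i ≤ 1 - F i)
    (h0 : 0 ≤ e) (h1 : e < 1) (he : ∏ i, (1 - x i) ≤ 1 - e) :
    (∏ i, F i) * (e + e ^ 2 / 2) ≤ ∑ i, x i * ∏ j ∈ Finset.univ.erase i, F j := by
  have hterm : ∀ i, x i * ∏ j ∈ Finset.univ.erase i, F j = (∏ j, F j) * (x i / F i) := by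
    intro i
    rw [← Finset.mul_prod_erase _ _ (Finset.mem_univ i)]
    have := (hF i).ne'
    field_simp
  simp_rw [hterm, ← Finset.mul_sum]
  refine mul_le_mul_of_nonneg_left ?_ (Finset.prod_nonneg fun i _ => (hF i).le)
  refine (add_sq_half_le_neg_log h0 h1).trans ?_
  have hpos : ∀ i, 0 < 1 - x i := fun i => by linarith [hF i, hx1 i]
  have hlog : Real.log (∏ i, (1 - x i)) ≤ Real.log (1 - e) :=
    Real.log_le_log (Finset.prod_pos fun i _ => hpos i) he
  rw [Real.log_prod (fun i _ => (hpos i).ne')] at hlog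
  have hi : ∀ i, -Real.log (1 - x i) ≤ x i / F i := by
    intro i
    rw [← Real.log_inv]
    refine (Real.log_le_sub_one_of_pos (inv_pos.2 (hpos i))).trans ?_
    have h2 : (1 - x i)⁻¹ - 1 = x i / (1 - x i) := by
      have := (hpos i).ne'
      field_simp; ring
    rw [h2]
    exact div_le_div_of_nonneg_left (hx0 i) (hF i) (by linarith [hx1 i])
  calc -Real.log (1 - e) ≤ ∑ i, -Real.log (1 - x i) := by
        rw [Finset.sum_neg_distrib]; linarith
    _ ≤ _ := Finset.sum_le_sum fun i _ => hi i

/-! ### The maximum and the collected value of one realization. -/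

theorem le_maxVal {n : ℕ} (v : Fin n → ℝ) (i : Fin n) : v i ≤ maxVal v :=
  le_ciSup (Set.finite_range v).bddAbove i

theorem exists_eq_maxVal {n : ℕ} [Nonempty (Fin n)] (v : Fin n → ℝ) : ∃ i, v i = maxVal v :=
  exists_eq_ciSup_of_finite

theorem measurable_maxVal {n : ℕ} : Measurable (maxVal : (Fin n → ℝ) → ℝ) :=
  Measurable.iSup fun i => measurable_pi_apply i

theorem exists_thresholdVal_eq {n : ℕ} {v : Fin n → ℝ} {ζ : ℝ} (h : ∃ i, ζ ≤ v i) :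
    ∃ i, ζ ≤ v i ∧ (∀ j < i, v j < ζ) ∧ thresholdVal v ζ = v i := by
  classical
  obtain ⟨i, hi⟩ := h
  have hne : (Finset.univ.filter fun i => ζ ≤ v i).Nonempty := ⟨i, by simpa using hi⟩
  refine ⟨(Finset.univ.filter fun i => ζ ≤ v i).min' hne, ?_, ?_, ?_⟩
  · simpa using Finset.min'_mem _ hne
  · intro j hj
    by_contra! hc
    exact absurd (Finset.min'_le _ j (by simpa using hc)) (not_le.2 hj)
  · unfold thresholdVal
    rw [dif_pos]

theorem thresholdVal_of_lt {n : ℕ} {v : Fin n → ℝ} {ζ : ℝ} (h : ∀ i, v i < ζ) :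
    thresholdVal v ζ = 0 := by
  unfold thresholdVal
  rw [dif_neg]
  rintro ⟨i, hi⟩
  exact absurd (h i) (not_lt.2 (by simpa using hi))

theorem thresholdVal_of_first {n : ℕ} {v : Fin n → ℝ} {ζ : ℝ} {i : Fin n} (hi : ζ ≤ v i)
    (h : ∀ j < i, v j < ζ) : thresholdVal v ζ = v i := by
  obtain ⟨k, hk, hk', hkv⟩ := exists_thresholdVal_eq ⟨i, hi⟩
  rcases lt_trichotomy i k with hik | rfl | hik
  · exact absurd (hk' i hik) (not_lt.2 hi)
  · exact hkv
  · exact absurd (h k hik) (not_lt.2 hk)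

theorem thresholdVal_of_unique {n : ℕ} {v : Fin n → ℝ} {ζ : ℝ} {i : Fin n} (hi : ζ ≤ v i)
    (h : ∀ j ≠ i, v j < ζ) : thresholdVal v ζ = v i :=
  thresholdVal_of_first hi fun j hj => h j hj.ne

theorem thresholdVal_congr {n : ℕ} {v : Fin n → ℝ} {ζ ζ' : ℝ} (h : ∀ i, ζ ≤ v i ↔ ζ' ≤ v i) :
    thresholdVal v ζ = thresholdVal v ζ' := by
  by_cases hex : ∃ i, ζ ≤ v i
  · obtain ⟨i, hi, hi', hv⟩ := exists_thresholdVal_eq hex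
    rw [hv, thresholdVal_of_first ((h i).1 hi) fun j hj => ?_]
    exact lt_of_not_ge fun hc => absurd (hi' j hj) (not_lt.2 ((h j).2 hc))
  · push Not at hex
    rw [thresholdVal_of_lt hex, thresholdVal_of_lt fun i => ?_]
    exact lt_of_not_ge fun hc => absurd (hex i) (not_lt.2 ((h i).2 hc))

theorem thresholdVal_le_maxVal {n : ℕ} {v : Fin n → ℝ} {ζ : ℝ} (hv : 0 ≤ maxVal v) :
    thresholdVal v ζ ≤ maxVal v := by
  by_cases hex : ∃ i, ζ ≤ v i
  · obtain ⟨i, -, -, h⟩ := exists_thresholdVal_eq hex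
    exact h ▸ le_maxVal v i
  · push Not at hex
    rwa [thresholdVal_of_lt hex]

theorem thresholdVal_eq_zero {n : ℕ} {v : Fin n → ℝ} {ζ : ℝ} (h : maxVal v < ζ) :
    thresholdVal v ζ = 0 :=
  thresholdVal_of_lt fun i => (le_maxVal v i).trans_lt h

theorem le_thresholdVal {n : ℕ} [Nonempty (Fin n)] {v : Fin n → ℝ} {ζ : ℝ} (h : ζ ≤ maxVal v) :
    ζ ≤ thresholdVal v ζ := by
  obtain ⟨i, hi⟩ := exists_eq_maxVal v
  obtain ⟨j, hj, -, hv⟩ := exists_thresholdVal_eq ⟨i, hi ▸ h⟩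
  exact hv ▸ hj

theorem thresholdVal_nonneg {n : ℕ} [Nonempty (Fin n)] {v : Fin n → ℝ} {ζ : ℝ} (h : 0 ≤ ζ) :
    0 ≤ thresholdVal v ζ := by
  rcases lt_or_ge (maxVal v) ζ with h' | h'
  · rw [thresholdVal_eq_zero h']
  · exact h.trans (le_thresholdVal h')

/-- An entry accepted only under the lower threshold is below `ζ'`, hence below what the higher
threshold collects. -/
theorem thresholdVal_mono {n : ℕ} {v : Fin n → ℝ} {ζ ζ' : ℝ} (h : ζ ≤ ζ') (h' : ∃ i, ζ' ≤ v i) :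
    thresholdVal v ζ ≤ thresholdVal v ζ' := by
  obtain ⟨i, hi, hi', hv⟩ := exists_thresholdVal_eq h'
  obtain ⟨j, hj, hj', hw⟩ := exists_thresholdVal_eq ⟨i, h.trans hi⟩
  rw [hv, hw]
  by_contra! hc
  have hji : j ≠ i := fun h => by subst h; exact lt_irrefl _ hc
  rcases lt_or_gt_of_ne hji with h1 | h1
  · exact absurd (hi' j h1) (not_lt.2 (hi.trans hc.le))
  · exact absurd (hj' i h1) (not_lt.2 (h.trans hi))

theorem abs_thresholdVal_le {n : ℕ} (v : Fin n → ℝ) (ζ : ℝ) : |thresholdVal v ζ| ≤ ∑ i, |v i| := by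
  by_cases hex : ∃ i, ζ ≤ v i
  · obtain ⟨i, -, -, h⟩ := exists_thresholdVal_eq hex
    rw [h]
    exact Finset.single_le_sum (f := fun i => |v i|) (fun i _ => abs_nonneg _) (Finset.mem_univ i)
  · push Not at hex
    rw [thresholdVal_of_lt hex, abs_zero]
    exact Finset.sum_nonneg fun i _ => abs_nonneg _

theorem abs_maxVal_le {n : ℕ} [Nonempty (Fin n)] (v : Fin n → ℝ) : |maxVal v| ≤ ∑ i, |v i| := by
  obtain ⟨i, hi⟩ := exists_eq_maxVal v
  rw [← hi]
  exact Finset.single_le_sum (f := fun i => |v i|) (fun i _ => abs_nonneg _) (Finset.mem_univ i)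

open Classical in
theorem thresholdVal_eq_sum {n : ℕ} (v : Fin n → ℝ) (ζ : ℝ) :
    thresholdVal v ζ = ∑ i, if ζ ≤ v i ∧ ∀ j, j < i → v j < ζ then v i else 0 := by
  by_cases hex : ∃ i, ζ ≤ v i
  · obtain ⟨i, hi, hi', h⟩ := exists_thresholdVal_eq hex
    rw [h, Finset.sum_eq_single i, if_pos ⟨hi, hi'⟩]
    · intro k _ hk
      rw [if_neg]
      rintro ⟨h1, h2⟩
      rcases lt_or_gt_of_ne hk with h3 | h3
      · exact absurd (hi' k h3) (not_lt.2 h1)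
      · exact absurd (h2 i h3) (not_lt.2 hi)
    · simp
  · push Not at hex
    rw [thresholdVal_of_lt hex, Finset.sum_eq_zero]
    intro i _
    rw [if_neg fun h => absurd (hex i) (not_lt.2 h.1)]

theorem measurable_thresholdVal {n : ℕ} {ζ : (Fin n → ℝ) → ℝ} (hζ : Measurable ζ) :
    Measurable fun v => thresholdVal v (ζ v) := by
  simp_rw [thresholdVal_eq_sum]
  refine Finset.measurable_sum _ fun i _ => Measurable.ite ?_ (measurable_pi_apply i)
    measurable_const
  refine (measurableSet_le hζ (measurable_pi_apply i)).inter ?_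
  have : {v : Fin n → ℝ | ∀ j, j < i → v j < ζ v} = ⋂ j, ⋂ (_ : j < i), {v | v j < ζ v} := by
    ext; simp
  change MeasurableSet {v : Fin n → ℝ | ∀ j, j < i → v j < ζ v}
  rw [this]
  exact MeasurableSet.iInter fun j => MeasurableSet.iInter fun _ =>
    measurableSet_lt (measurable_pi_apply j) hζ

/-! ### Integrability and first consequences of the threshold equation. -/

namespace ProphetInstance

variable (X : ProphetInstance)

instance : Nonempty (Fin X.n) := ⟨⟨0, X.n_pos⟩⟩

instance : IsProbabilityMeasure X.joint := by unfold joint; infer_instance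

theorem measurePreserving_coord (i : Fin X.n) :
    MeasurePreserving (Function.eval i) X.joint (X.law i) :=
  measurePreserving_eval X.law i

theorem integral_coord (i : Fin X.n) {g : ℝ → ℝ} (hg : Measurable g) :
    ∫ v, g (v i) ∂X.joint = ∫ x, g x ∂X.law i := by
  rw [← (X.measurePreserving_coord i).map_eq, integral_map (measurable_pi_apply i).aemeasurable
    hg.aestronglyMeasurable]

theorem integrable_coord (i : Fin X.n) : Integrable (fun v => v i) X.joint :=
  (X.measurePreserving_coord i).integrable_comp_of_integrable (X.integrable i)

theorem ae_nonneg : ∀ᵐ v ∂X.joint, ∀ i, 0 ≤ v i :=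
  ae_all_iff.2 fun i => (X.measurePreserving_coord i).quasiMeasurePreserving.ae (X.nonneg i)

theorem ae_maxVal_nonneg : ∀ᵐ v ∂X.joint, 0 ≤ maxVal v := by
  filter_upwards [X.ae_nonneg] with v hv
  exact (hv ⟨0, X.n_pos⟩).trans (le_maxVal v _)

theorem integrable_sum_abs : Integrable (fun v => ∑ i, |v i|) X.joint :=
  integrable_finsetSum _ fun i _ => (X.integrable_coord i).abs

theorem integrable_maxVal : Integrable maxVal X.joint :=
  X.integrable_sum_abs.mono' measurable_maxVal.aestronglyMeasurable
    (Filter.Eventually.of_forall abs_maxVal_le)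

theorem measurable_talVal (α τ : ℝ) :
    Measurable fun v : Fin X.n → ℝ => thresholdVal v (max τ (α * maxVal v)) :=
  measurable_thresholdVal (measurable_const.max (measurable_maxVal.const_mul α))

theorem integrable_talVal (α τ : ℝ) :
    Integrable (fun v => thresholdVal v (max τ (α * maxVal v))) X.joint :=
  X.integrable_sum_abs.mono' (X.measurable_talVal α τ).aestronglyMeasurable
    (Filter.Eventually.of_forall fun v => abs_thresholdVal_le v _)

theorem measurableSet_le_maxVal (τ : ℝ) : MeasurableSet {v : Fin X.n → ℝ | τ ≤ maxVal v} :=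
  measurableSet_le measurable_const measurable_maxVal

theorem opt_nonneg : 0 ≤ X.opt := integral_nonneg_of_ae X.ae_maxVal_nonneg

theorem tal_nonneg {α τ : ℝ} (hτ : 0 ≤ τ) : 0 ≤ X.tal α τ :=
  integral_nonneg fun _ => thresholdVal_nonneg (hτ.trans (le_max_left _ _))

theorem ae_maxVal_eq_zero (h : X.opt = 0) : ∀ᵐ v ∂X.joint, maxVal v = 0 :=
  (integral_eq_zero_iff_of_nonneg_ae X.ae_maxVal_nonneg X.integrable_maxVal).1 h

theorem tal_eq_zero (h : X.opt = 0) {α τ : ℝ} (hτ : 0 ≤ τ) : X.tal α τ = 0 := by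
  refine integral_eq_zero_of_ae ?_
  filter_upwards [X.ae_maxVal_eq_zero h] with v hv
  exact le_antisymm ((thresholdVal_le_maxVal hv.ge).trans_eq hv)
    (thresholdVal_nonneg (hτ.trans (le_max_left _ _)))

theorem opt_pos_of_isContinuous (h : X.IsContinuous) : 0 < X.opt := by
  refine lt_of_le_of_ne X.opt_nonneg fun h0 => ?_
  have h1 : ∀ᵐ v ∂X.joint, v ⟨0, X.n_pos⟩ = 0 := by
    filter_upwards [X.ae_maxVal_eq_zero h0.symm, X.ae_nonneg] with v hv hv'
    exact le_antisymm ((le_maxVal v _).trans_eq hv) (hv' _)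
  have h2 : ∀ᵐ v ∂X.joint, v ⟨0, X.n_pos⟩ ≠ 0 :=
    (X.measurePreserving_coord ⟨0, X.n_pos⟩).quasiMeasurePreserving.ae
      (p := fun x => x ≠ 0) (measure_eq_zero_iff_ae_notMem.1 (h _ 0))
  have h3 : ∀ᵐ v ∂X.joint, False := by
    filter_upwards [h1, h2] with v a b using b a
  exact h3.exists.choose_spec

theorem setIntegral_lt_eq {τ : ℝ} (h : X.IsBaseThreshold (3 / 4) τ) :
    ∫ v in {v | maxVal v < τ}, maxVal v ∂X.joint = X.opt / 4 := by
  have h1 := integral_add_compl (X.measurableSet_le_maxVal τ) X.integrable_maxVal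
  have h2 : {v : Fin X.n → ℝ | τ ≤ maxVal v}ᶜ = {v | maxVal v < τ} := by ext; simp
  rw [h2, h.2] at h1
  change _ = X.opt at h1
  linarith

/-- The probability that the maximum stays below `τ`. -/
noncomputable def probLt (τ : ℝ) : ℝ := X.joint.real {v | maxVal v < τ}

theorem probLt_eq_prod (τ : ℝ) : X.probLt τ = ∏ i, (X.law i).real (Set.Iio τ) := by
  have h : {v : Fin X.n → ℝ | maxVal v < τ} = Set.univ.pi fun _ => Set.Iio τ := by
    ext v
    simp only [Set.mem_ofPred_eq, Set.mem_pi, Set.mem_univ, true_imp_iff, Set.mem_Iio]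
    refine ⟨fun h i => (le_maxVal v i).trans_lt h, fun h => ?_⟩
    obtain ⟨i, hi⟩ := exists_eq_maxVal v
    exact hi ▸ h i
  rw [probLt, h, measureReal_def, joint, Measure.pi_pi, ENNReal.toReal_prod]
  rfl

theorem measureReal_le_maxVal (τ : ℝ) : X.joint.real {v | τ ≤ maxVal v} = 1 - X.probLt τ := by
  have h := probReal_add_probReal_compl (μ := X.joint) (X.measurableSet_le_maxVal τ)
  have h2 : {v : Fin X.n → ℝ | τ ≤ maxVal v}ᶜ = {v | maxVal v < τ} := by ext; simp
  rw [h2] at h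
  exact eq_sub_of_add_eq h

theorem probLt_le_one (τ : ℝ) : X.probLt τ ≤ 1 := measureReal_le_one

/-- The missing quarter of `OPT` lives on `M < τ`. This forces both `τ` and `P(M < τ)` to be
positive when `OPT > 0`. -/
theorem opt_div_four_le {τ : ℝ} (h : X.IsBaseThreshold (3 / 4) τ) :
    X.opt / 4 ≤ X.probLt τ * τ := by
  rw [← X.setIntegral_lt_eq h]
  have hm : MeasurableSet {v : Fin X.n → ℝ | maxVal v < τ} :=
    measurableSet_lt measurable_maxVal measurable_const
  calc ∫ v in {v | maxVal v < τ}, maxVal v ∂X.joint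
      ≤ ∫ v in {v | maxVal v < τ}, τ ∂X.joint :=
        setIntegral_mono_on X.integrable_maxVal.integrableOn (integrable_const _).integrableOn hm
          fun v hv => le_of_lt hv
    _ = X.probLt τ * τ := by simp [probLt]

theorem probLt_pos {τ : ℝ} (h : X.IsBaseThreshold (3 / 4) τ) (ho : 0 < X.opt) :
    0 < X.probLt τ := by
  have h1 := X.opt_div_four_le h
  by_contra! hc
  nlinarith [h.1]

theorem threshold_pos {τ : ℝ} (h : X.IsBaseThreshold (3 / 4) τ) (ho : 0 < X.opt) : 0 < τ := by
  have h1 := X.opt_div_four_le h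
  by_contra! hc
  rw [le_antisymm hc h.1] at h1
  linarith

theorem law_Iio_pos {τ : ℝ} (h : 0 < X.probLt τ) (i : Fin X.n) :
    0 < (X.law i).real (Set.Iio τ) := by
  refine lt_of_le_of_ne measureReal_nonneg fun h0 => ?_
  rw [probLt_eq_prod, Finset.prod_eq_zero (Finset.mem_univ i) h0.symm] at h
  exact lt_irrefl _ h

end ProphetInstance

/-! ### Splitting the collected value into threshold and excess. -/

/-- The clipped function `min (α x) τ - α τ`, cut off at `0`. -/
noncomputable def clip (α τ x : ℝ) : ℝ := max (min (α * x) τ - α * τ) 0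

/-- The excess of `x` over the effective threshold `max τ (α x)`, cut off at `0`. -/
noncomputable def excess (α τ x : ℝ) : ℝ := (1 - α) * max (x - τ) 0 + clip α τ x

section excess

variable {α τ : ℝ}

theorem measurable_clip : Measurable (clip α τ) := by unfold clip; fun_prop

theorem clip_nonneg (x : ℝ) : 0 ≤ clip α τ x := le_max_right _ _

theorem clip_le (h1 : α ≤ 1) (hτ : 0 ≤ τ) (x : ℝ) : clip α τ x ≤ (1 - α) * τ :=
  max_le (by linarith [min_le_right (α * x) τ]) (mul_nonneg (by linarith) hτ)

theorem clip_of_lt (h0 : 0 ≤ α) {x : ℝ} (hx : x < τ) : clip α τ x = 0 :=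
  max_eq_right (by linarith [min_le_left (α * x) τ, mul_le_mul_of_nonneg_left hx.le h0])

theorem excess_nonneg (h1 : α ≤ 1) (x : ℝ) : 0 ≤ excess α τ x :=
  add_nonneg (mul_nonneg (by linarith) (le_max_right _ _)) (clip_nonneg x)

theorem excess_of_lt (h0 : 0 ≤ α) {x : ℝ} (hx : x < τ) : excess α τ x = 0 := by
  rw [excess, clip_of_lt h0 hx, max_eq_right (by linarith)]
  ring

theorem clip_of_le (h0 : 0 ≤ α) (h1 : α ≤ 1) (hτ : 0 ≤ τ) {x : ℝ} (hx : τ ≤ x) :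
    clip α τ x = min (α * x) τ - α * τ :=
  max_eq_left <| sub_nonneg.2 <| le_min (mul_le_mul_of_nonneg_left hx h0)
    (mul_le_of_le_one_left hτ h1)

theorem max_add_excess (h0 : 0 ≤ α) (h1 : α ≤ 1) (hτ : 0 ≤ τ) {x : ℝ} (hx : τ ≤ x) :
    max τ (α * x) + excess α τ x = x := by
  rw [excess, clip_of_le h0 h1 hτ hx, max_eq_left (sub_nonneg.2 hx)]
  linarith [min_add_max τ (α * x), min_comm τ (α * x)]

/-- The same `clip` enters the threshold term negatively and the excess positively, so its mean is
the only extra parameter. -/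
theorem max_mul_sub_eq (h0 : 0 ≤ α) (h1 : α ≤ 1) (hτ : 0 ≤ τ) (x : ℝ) :
    max (α * x - τ) 0 = α * max (x - τ) 0 - clip α τ x := by
  rcases lt_or_ge x τ with hx | hx
  · rw [clip_of_lt h0 hx, max_eq_right (by linarith : x - τ ≤ 0), max_eq_right]
    · ring
    · nlinarith
  · rw [clip_of_le h0 h1 hτ hx, max_eq_left (sub_nonneg.2 hx)]
    rcases le_total (α * x) τ with h | h
    · rw [max_eq_right (by linarith), min_eq_left h]; ring
    · rw [max_eq_left (by linarith), min_eq_right h]; ring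

end excess

/-- The factor at coordinate `j` of the product that is `excess α τ (v i)` when all entries other
than `v i` are below `τ`, and `0` otherwise. -/
noncomputable def soloFactor {n : ℕ} (α τ : ℝ) (i j : Fin n) (x : ℝ) : ℝ :=
  if j = i then excess α τ x else (Set.Iio τ).indicator 1 x

theorem prod_soloFactor {n : ℕ} (α τ : ℝ) (i : Fin n) (v : Fin n → ℝ) :
    ∏ j, soloFactor α τ i j (v j) =
      excess α τ (v i) * ∏ j ∈ Finset.univ.erase i, (Set.Iio τ).indicator 1 (v j) := by
  rw [← Finset.mul_prod_erase _ _ (Finset.mem_univ i), soloFactor, if_pos rfl]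
  congr 1
  exact Finset.prod_congr rfl fun j hj => by rw [soloFactor, if_neg (Finset.ne_of_mem_erase hj)]

/-- The realized value is at least the effective threshold, and a unique entry above `τ` is
collected in full. -/
theorem thresholdVal_ge {n : ℕ} [Nonempty (Fin n)] {α τ : ℝ} (h0 : 0 ≤ α) (h1 : α ≤ 1)
    (hτ : 0 ≤ τ) (v : Fin n → ℝ) :
    {v : Fin n → ℝ | τ ≤ maxVal v}.indicator (fun _ => τ) v + max (α * maxVal v - τ) 0 +
      ∑ i, ∏ j, soloFactor α τ i j (v j) ≤ thresholdVal v (max τ (α * maxVal v)) := by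
  simp_rw [prod_soloFactor]
  rcases lt_or_ge (maxVal v) τ with hM | hM
  · have hlt : ∀ i, v i < τ := fun i => (le_maxVal v i).trans_lt hM
    rw [Set.indicator_of_notMem (by simpa using hM), max_eq_right (by nlinarith),
      thresholdVal_eq_zero (hM.trans_le (le_max_left _ _)), Finset.sum_eq_zero]
    · simp
    · intro i _
      rw [excess_of_lt h0 (hlt i), zero_mul]
  rw [Set.indicator_of_mem (by simpa using hM)]
  have hW : τ + max (α * maxVal v - τ) 0 = max τ (α * maxVal v) := by
    rw [add_comm, max_add, max_comm]; congr 1 <;> ring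
  rw [hW]
  have hWM : max τ (α * maxVal v) ≤ maxVal v :=
    max_le hM (mul_le_of_le_one_left (hτ.trans hM) h1)
  obtain ⟨i, hi⟩ := exists_eq_maxVal v
  by_cases hu : ∀ j ≠ i, v j < τ
  · rw [Finset.sum_eq_single i]
    · rw [Finset.prod_eq_one fun j hj => Set.indicator_of_mem
        (show v j ∈ Set.Iio τ from hu j (Finset.ne_of_mem_erase hj)) _, mul_one, hi,
        max_add_excess h0 h1 hτ hM, thresholdVal_of_unique (hi ▸ hWM) fun j hj =>
          (hu j hj).trans_le (le_max_left _ _), hi]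
    · intro k _ hk
      rw [excess_of_lt h0 (hu k hk), zero_mul]
    · simp
  -- Two entries reach `τ`: every product contains a vanishing indicator, at `j` if `k = i` and at
  -- `i` otherwise.
  · push Not at hu
    obtain ⟨j, hj, hjτ⟩ := hu
    rw [Finset.sum_eq_zero, add_zero]
    · exact le_thresholdVal hWM
    · intro k _
      by_cases hk : k = i
      · rw [Finset.prod_eq_zero (Finset.mem_erase.2 ⟨hk ▸ hj, Finset.mem_univ j⟩), mul_zero]
        exact Set.indicator_of_notMem (by simpa using hjτ) _
      · rw [Finset.prod_eq_zero (Finset.mem_erase.2 ⟨Ne.symm hk, Finset.mem_univ i⟩), mul_zero]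
        exact Set.indicator_of_notMem (by simpa [hi] using hM) _

/-- One factor is `1 - f (maxVal v)` and the others lie in `[0, 1]`. Integrated over independent
entries, this gives the product hypothesis of `sum_mul_prod_erase_ge`. -/
theorem prod_one_sub_le {n : ℕ} [Nonempty (Fin n)] {f : ℝ → ℝ} (hf0 : ∀ x, 0 ≤ f x)
    (hf1 : ∀ x, f x ≤ 1) (v : Fin n → ℝ) : ∏ i, (1 - f (v i)) ≤ 1 - f (maxVal v) := by
  obtain ⟨i, hi⟩ := exists_eq_maxVal v
  rw [← Finset.mul_prod_erase _ _ (Finset.mem_univ i), hi]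
  exact mul_le_of_le_one_right (sub_nonneg.2 (hf1 _))
    (Finset.prod_le_one (fun j _ => sub_nonneg.2 (hf1 _)) fun j _ => sub_le_self _ (hf0 _))

/-! ### Expectations and the guarantee for every instance. -/

namespace ProphetInstance

variable (X : ProphetInstance) {α τ : ℝ}

/-- The expected excess of the maximum over `τ`. -/
noncomputable def tailExcess (τ : ℝ) : ℝ := ∫ v, max (maxVal v - τ) 0 ∂X.joint

/-- The expected clipped maximum. -/
noncomputable def clipMean (α τ : ℝ) : ℝ := ∫ v, clip α τ (maxVal v) ∂X.joint

theorem integrable_tailExcess (τ : ℝ) :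
    Integrable (fun v => max (maxVal v - τ) 0) X.joint :=
  (X.integrable_maxVal.sub (integrable_const τ)).pos_part

theorem integrable_law_tailExcess (τ : ℝ) (i : Fin X.n) :
    Integrable (fun x => max (x - τ) 0) (X.law i) :=
  ((X.integrable i).sub (integrable_const τ)).pos_part

theorem integrable_clip {Ω : Type*} [MeasurableSpace Ω] {μ : Measure Ω} [IsProbabilityMeasure μ]
    (h1 : α ≤ 1) (hτ : 0 ≤ τ) {f : Ω → ℝ} (hf : Measurable f) :
    Integrable (fun ω => clip α τ (f ω)) μ :=
  Integrable.of_bound (measurable_clip.comp hf).aestronglyMeasurable ((1 - α) * τ)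
    (Filter.Eventually.of_forall fun ω => by
      rw [Real.norm_of_nonneg (clip_nonneg _)]; exact clip_le h1 hτ _)

theorem tailExcess_eq {c : ℝ} (h : X.IsBaseThreshold c τ) :
    X.tailExcess τ = c * X.opt - (1 - X.probLt τ) * τ := by
  have hm := X.measurableSet_le_maxVal τ
  have h1 : ∀ v : Fin X.n → ℝ, max (maxVal v - τ) 0 =
      {v : Fin X.n → ℝ | τ ≤ maxVal v}.indicator (fun v => maxVal v - τ) v := by
    intro v
    by_cases hv : τ ≤ maxVal v
    · rw [Set.indicator_of_mem (by simpa using hv), max_eq_left (by linarith)]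
    · rw [Set.indicator_of_notMem (by simpa using hv), max_eq_right (by linarith)]
  rw [tailExcess, integral_congr_ae (Filter.Eventually.of_forall h1), integral_indicator hm,
    integral_sub X.integrable_maxVal.integrableOn (integrable_const _).integrableOn, h.2]
  simp [← X.measureReal_le_maxVal]

theorem integral_max_mul_sub (h0 : 0 ≤ α) (h1 : α ≤ 1) (hτ : 0 ≤ τ) :
    ∫ v, max (α * maxVal v - τ) 0 ∂X.joint = α * X.tailExcess τ - X.clipMean α τ := by
  simp_rw [max_mul_sub_eq h0 h1 hτ]
  rw [integral_sub ((X.integrable_tailExcess τ).const_mul α)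
    (integrable_clip h1 hτ measurable_maxVal), integral_const_mul]
  rfl

theorem clipMean_le (h0 : 0 ≤ α) (h1 : α ≤ 1) (hτ : 0 ≤ τ) :
    X.clipMean α τ ≤ α * X.tailExcess τ := by
  rw [← sub_nonneg, ← X.integral_max_mul_sub h0 h1 hτ]
  exact integral_nonneg fun v => le_max_right _ _

theorem integral_clip_le {Ω : Type*} [MeasurableSpace Ω] {μ : Measure Ω} [IsProbabilityMeasure μ]
    (h0 : 0 ≤ α) (h1 : α ≤ 1) (hτ : 0 ≤ τ) {f : Ω → ℝ} (hf : Measurable f) :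
    ∫ ω, clip α τ (f ω) ∂μ ≤ (1 - α) * τ * (1 - μ.real {ω | f ω < τ}) := by
  have hm : MeasurableSet {ω | f ω < τ} := measurableSet_lt hf measurable_const
  calc ∫ ω, clip α τ (f ω) ∂μ ≤ ∫ ω, {ω | f ω < τ}ᶜ.indicator (fun _ => (1 - α) * τ) ω ∂μ := by
        refine integral_mono (integrable_clip h1 hτ hf)
          ((integrable_const _).indicator hm.compl) fun ω => ?_
        by_cases hω : f ω < τ
        · simp [clip_of_lt h0 hω, hω]
        · simpa [hω] using clip_le h1 hτ (f ω)
    _ = _ := by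
        rw [integral_indicator_const _ hm.compl, probReal_compl_eq_one_sub hm, smul_eq_mul]
        ring

theorem tailExcess_le_sum (τ : ℝ) :
    X.tailExcess τ ≤ ∑ i, ∫ x, max (x - τ) 0 ∂X.law i := by
  have h : ∀ i, Integrable (fun v : Fin X.n → ℝ => max (v i - τ) 0) X.joint := fun i =>
    ((X.integrable_coord i).sub (integrable_const τ)).pos_part
  simp_rw [← fun i => X.integral_coord i (g := fun x => max (x - τ) 0) (by fun_prop)]
  rw [← integral_finsetSum _ fun i _ => h i]
  refine integral_mono (X.integrable_tailExcess τ) (integrable_finsetSum _ fun i _ => h i)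
    fun v => ?_
  obtain ⟨i, hi⟩ := exists_eq_maxVal v
  simp only [← hi]
  exact Finset.single_le_sum (f := fun i => max (v i - τ) 0) (fun i _ => le_max_right _ _)
    (Finset.mem_univ i)

theorem integral_excess (h1 : α ≤ 1) (hτ : 0 ≤ τ) (i : Fin X.n) :
    ∫ x, excess α τ x ∂X.law i =
      (1 - α) * ∫ x, max (x - τ) 0 ∂X.law i + ∫ x, clip α τ x ∂X.law i := by
  have hc : Integrable (clip α τ) (X.law i) := integrable_clip h1 hτ measurable_id
  unfold excess
  rw [integral_add ((X.integrable_law_tailExcess τ i).const_mul _) hc, integral_const_mul]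

theorem integrable_soloFactor (h1 : α ≤ 1) (hτ : 0 ≤ τ) (i j : Fin X.n) :
    Integrable (soloFactor α τ i j) (X.law j) := by
  unfold soloFactor
  by_cases h : j = i
  · simp only [h, if_true]
    exact ((X.integrable_law_tailExcess τ i).const_mul _).add
      (integrable_clip h1 hτ measurable_id)
  · simp only [h, if_false]
    exact (integrable_const (1 : ℝ)).indicator measurableSet_Iio

theorem integral_prod_soloFactor (i : Fin X.n) :
    ∫ v, ∏ j, soloFactor α τ i j (v j) ∂X.joint =
      (∫ x, excess α τ x ∂X.law i) * ∏ j ∈ Finset.univ.erase i, (X.law j).real (Set.Iio τ) := by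
  rw [joint, integral_fintype_prod_eq_prod, ← Finset.mul_prod_erase _ _ (Finset.mem_univ i)]
  congr 1
  · simp [soloFactor]
  · refine Finset.prod_congr rfl fun j hj => ?_
    simp only [soloFactor, if_neg (Finset.ne_of_mem_erase hj)]
    exact integral_indicator_one measurableSet_Iio

theorem tal_ge_sum (h0 : 0 ≤ α) (h1 : α ≤ 1) (hτ : 0 ≤ τ) :
    (1 - X.probLt τ) * τ + (α * X.tailExcess τ - X.clipMean α τ) +
      ∑ i, (∫ x, excess α τ x ∂X.law i) *
        ∏ j ∈ Finset.univ.erase i, (X.law j).real (Set.Iio τ) ≤ X.tal α τ := by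
  have hm := X.measurableSet_le_maxVal τ
  have i1 : Integrable (fun v => {v : Fin X.n → ℝ | τ ≤ maxVal v}.indicator (fun _ => τ) v)
      X.joint := (integrable_const _).indicator hm
  have i2 : Integrable (fun v => max (α * maxVal v - τ) 0) X.joint :=
    ((X.integrable_maxVal.const_mul α).sub (integrable_const τ)).pos_part
  have i3 : ∀ i : Fin X.n, Integrable (fun v => ∏ j, soloFactor α τ i j (v j)) X.joint := fun i =>
    Integrable.fintype_prod fun j => X.integrable_soloFactor h1 hτ i j
  have i12 : Integrable (fun v => {v : Fin X.n → ℝ | τ ≤ maxVal v}.indicator (fun _ => τ) v +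
      max (α * maxVal v - τ) 0) X.joint := i1.add i2
  have i4 := integrable_finsetSum Finset.univ fun i _ => i3 i
  have key := integral_mono (i12.add i4) (X.integrable_talVal α τ) (thresholdVal_ge h0 h1 hτ)
  rw [integral_add' i12 i4, integral_add i1 i2,
    integral_finsetSum _ fun i _ => i3 i, integral_indicator_const _ hm,
    X.measureReal_le_maxVal, X.integral_max_mul_sub h0 h1 hτ] at key
  simp only [X.integral_prod_soloFactor, smul_eq_mul] at key
  exact key

/-- For the linear part each product over the other entries is at least `P(M < τ)`, and the union
bound applies. The clipped part, rescaled to `[0, 1]`, goes through `sum_mul_prod_erase_ge`. -/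
theorem sum_excess_ge (h0 : 0 ≤ α) (h1 : α < 1) (hτ : 0 < τ) (hq : 0 < X.probLt τ) {e : ℝ}
    (he : X.clipMean α τ = (1 - α) * τ * e) :
    (1 - α) * X.probLt τ * X.tailExcess τ + (1 - α) * τ * (X.probLt τ * (e + e ^ 2 / 2)) ≤
      ∑ i, (∫ x, excess α τ x ∂X.law i) *
        ∏ j ∈ Finset.univ.erase i, (X.law j).real (Set.Iio τ) := by
  have h1' : 0 < 1 - α := by linarith
  have hC : 0 < (1 - α) * τ := mul_pos h1' hτ
  set F : Fin X.n → ℝ := fun i => (X.law i).real (Set.Iio τ) with hF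
  have hq' : X.probLt τ = ∏ i, F i := X.probLt_eq_prod τ
  have hFpos : ∀ i, 0 < F i := X.law_Iio_pos hq
  have hF1 : ∀ i, F i ≤ 1 := fun i => measureReal_le_one
  simp_rw [X.integral_excess h1.le hτ.le, add_mul, Finset.sum_add_distrib]
  refine add_le_add ?_ ?_
  · calc (1 - α) * X.probLt τ * X.tailExcess τ
        ≤ (1 - α) * X.probLt τ * ∑ i, ∫ x, max (x - τ) 0 ∂X.law i :=
          mul_le_mul_of_nonneg_left (X.tailExcess_le_sum τ) (mul_nonneg h1'.le hq.le)
      _ ≤ _ := by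
          rw [Finset.mul_sum]
          refine Finset.sum_le_sum fun i _ => ?_
          have hI : 0 ≤ ∫ x, max (x - τ) 0 ∂X.law i := integral_nonneg fun x => le_max_right _ _
          have hprod : X.probLt τ ≤ ∏ j ∈ Finset.univ.erase i, F j := by
            rw [hq', ← Finset.mul_prod_erase _ _ (Finset.mem_univ i)]
            exact mul_le_of_le_one_left (Finset.prod_nonneg fun j _ => (hFpos j).le) (hF1 i)
          calc _ = (1 - α) * (∫ x, max (x - τ) 0 ∂X.law i) * X.probLt τ := by ring
            _ ≤ _ := mul_le_mul_of_nonneg_left hprod (mul_nonneg h1'.le hI)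
  · set x : Fin X.n → ℝ := fun i => ∫ y, clip α τ y / ((1 - α) * τ) ∂X.law i with hx
    have hxi : ∀ i, ∫ y, clip α τ y ∂X.law i = (1 - α) * τ * x i := by
      intro i
      simp only [hx]
      rw [integral_div, mul_div_cancel₀ _ hC.ne']
    have hx0 : ∀ i, 0 ≤ x i := fun i =>
      integral_nonneg fun y => div_nonneg (clip_nonneg y) hC.le
    have hx1 : ∀ i, x i ≤ 1 - F i := by
      intro i
      have := integral_clip_le (μ := X.law i) h0 h1.le hτ.le measurable_id
      simp only [id] at this
      rw [hxi] at this
      exact le_of_mul_le_mul_left this hC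
    have hei : ∫ v, clip α τ (maxVal v) / ((1 - α) * τ) ∂X.joint = e := by
      rw [integral_div]
      exact (div_eq_iff hC.ne').2 (by rw [mul_comm]; exact he)
    have he0 : 0 ≤ e := hei ▸ integral_nonneg fun v => div_nonneg (clip_nonneg _) hC.le
    have he1 : e ≤ 1 - X.probLt τ := by
      have := integral_clip_le (μ := X.joint) h0 h1.le hτ.le measurable_maxVal
      exact le_of_mul_le_mul_left (he.symm.trans_le this) hC
    have hle : ∏ i, (1 - x i) ≤ 1 - e := by
      have hint : ∀ i, Integrable (fun y => clip α τ y / ((1 - α) * τ)) (X.law i) := fun i =>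
        (integrable_clip h1.le hτ.le measurable_id).div_const _
      have hintM : Integrable (fun v => clip α τ (maxVal v) / ((1 - α) * τ)) X.joint :=
        (integrable_clip h1.le hτ.le measurable_maxVal).div_const _
      have h2 : ∏ i, (1 - x i) = ∫ v, ∏ i, (1 - clip α τ (v i) / ((1 - α) * τ)) ∂X.joint := by
        rw [joint, integral_fintype_prod_eq_prod (f := fun _ y => 1 - clip α τ y / ((1 - α) * τ))]
        refine Finset.prod_congr rfl fun i _ => ?_
        rw [integral_sub (integrable_const _) (hint i)]
        simp [hx]
      have h3 : 1 - e = ∫ v, (1 - clip α τ (maxVal v) / ((1 - α) * τ)) ∂X.joint := by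
        rw [integral_sub (integrable_const _) hintM, hei]
        simp
      rw [h2, h3]
      refine integral_mono
        (Integrable.fintype_prod (f := fun _ y => 1 - clip α τ y / ((1 - α) * τ))
          fun i => (integrable_const _).sub (hint i)) ((integrable_const _).sub hintM) fun v => ?_
      exact prod_one_sub_le (f := fun y => clip α τ y / ((1 - α) * τ))
        (fun y => div_nonneg (clip_nonneg y) hC.le)
        (fun y => (div_le_one hC).2 (clip_le h1.le hτ.le y)) v
    have key := sum_mul_prod_erase_ge hFpos hx0 hx1 he0 (by linarith) hle
    simp_rw [hxi, mul_assoc ((1 - α) * τ), ← Finset.mul_sum]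
    rw [hq']
    exact mul_le_mul_of_nonneg_left key hC.le

theorem tal_ge (h0 : 0 ≤ α) (h1 : α ≤ 1) (h : X.IsBaseThreshold (3 / 4) τ) :
    (1 / 2 + α ^ 3 / 4) * X.opt ≤ X.tal α τ := by
  rcases X.opt_nonneg.eq_or_lt with ho | ho
  · rw [← ho, mul_zero]; exact X.tal_nonneg h.1
  have hτ := X.threshold_pos h ho
  have hq := X.probLt_pos h ho
  have hB := X.tailExcess_eq h
  have hq4 := X.opt_div_four_le h
  have hsum := X.tal_ge_sum h0 h1 hτ.le
  have hG := X.clipMean_le h0 h1 hτ.le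
  have hG1 := integral_clip_le (μ := X.joint) h0 h1 hτ.le measurable_maxVal
  change X.clipMean α τ ≤ (1 - α) * τ * (1 - X.probLt τ) at hG1
  have hG0 : 0 ≤ X.clipMean α τ := integral_nonneg fun v => clip_nonneg _
  have hB0 : 0 ≤ X.tailExcess τ := integral_nonneg fun v => le_max_right _ _
  -- At `α = 1` the rescaling by `(1 - α) τ` breaks down, but there `clipMean ≤ 0` and the threshold
  -- terms alone give `3/4` of `OPT`.
  rcases h1.eq_or_lt with rfl | h1
  · have hs0 : 0 ≤ ∑ i, (∫ x, excess 1 τ x ∂X.law i) *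
        ∏ j ∈ Finset.univ.erase i, (X.law j).real (Set.Iio τ) :=
      Finset.sum_nonneg fun i _ => mul_nonneg (integral_nonneg fun x => excess_nonneg le_rfl x)
        (Finset.prod_nonneg fun j _ => measureReal_nonneg)
    nlinarith
  have h1' : 0 < 1 - α := by linarith
  have hC : 0 < (1 - α) * τ := mul_pos h1' hτ
  obtain ⟨e, he⟩ : ∃ e, X.clipMean α τ = (1 - α) * τ * e :=
    ⟨X.clipMean α τ / ((1 - α) * τ), (mul_div_cancel₀ _ hC.ne').symm⟩
  obtain ⟨b, hb⟩ : ∃ b, X.tailExcess τ = τ * b :=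
    ⟨X.tailExcess τ / τ, (mul_div_cancel₀ _ hτ.ne').symm⟩
  have hexc := X.sum_excess_ge h0 h1 hτ hq he
  obtain ⟨p, hp⟩ : ∃ p, X.probLt τ = 1 - p := ⟨1 - X.probLt τ, by ring⟩
  have hp0 : 0 ≤ p := by linarith [X.probLt_le_one τ]
  rw [he] at hG hG0 hG1 hsum
  rw [hb] at hG hB0 hB hsum hexc
  rw [hp] at hq hB hq4 hsum hexc hG1
  have hb0 : 0 ≤ b := nonneg_of_mul_nonneg_right hB0 hτ
  have he0 : 0 ≤ e := nonneg_of_mul_nonneg_right hG0 hC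
  have hep : e ≤ p := by
    have := le_of_mul_le_mul_left hG1 hC
    linarith
  have heb : (1 - α) * e ≤ α * b :=
    le_of_mul_le_mul_left (by linarith : τ * ((1 - α) * e) ≤ τ * (α * b)) hτ
  have hO : X.opt = 4 / 3 * (τ * (b + p)) := by linarith
  have hbp : b + p ≤ 3 * (1 - p) :=
    le_of_mul_le_mul_left (by rw [hO] at hq4; linarith : τ * (b + p) ≤ τ * (3 * (1 - p))) hτ
  have hineq := mul_le_mul_of_nonneg_left
    (loss_real_ineq h0 h1 hp0 (by linarith) hb0 he0 hep heb hbp) hC.le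
  rw [hO]
  linarith

end ProphetInstance

/-! ### Existence of base thresholds and independence of the choice. -/

namespace ProphetInstance

open Filter Topology in
-- Since `M` has no atoms, `τ ↦ E[M · 1[M ≥ τ]]` is continuous by dominated convergence. It falls
-- from `OPT` at `0` to `0` at infinity, so the intermediate value theorem applies.
theorem exists_isBaseThreshold (X : ProphetInstance) (hX : X.IsContinuous) {c : ℝ} (hc0 : 0 < c)
    (hc1 : c ≤ 1) : ∃ τ : ℝ, X.IsBaseThreshold c τ := by
  have ho := X.opt_pos_of_isContinuous hX
  set F : ℝ → (Fin X.n → ℝ) → ℝ := fun τ => {v | τ ≤ maxVal v}.indicator maxVal with hF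
  have hFint : ∀ τ, ∫ v in {v | τ ≤ maxVal v}, maxVal v ∂X.joint = ∫ v, F τ v ∂X.joint :=
    fun τ => (integral_indicator (X.measurableSet_le_maxVal τ)).symm
  have hmeas : ∀ τ, AEStronglyMeasurable (F τ) X.joint := fun τ =>
    (measurable_maxVal.indicator (X.measurableSet_le_maxVal τ)).aestronglyMeasurable
  have hbound : ∀ τ v, ‖F τ v‖ ≤ |maxVal v| := fun τ v => norm_indicator_le_norm_self _ _
  have hF0 : ∫ v, F 0 v ∂X.joint = X.opt := by
    refine integral_congr_ae ?_
    filter_upwards [X.ae_maxVal_nonneg] with v hv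
    exact Set.indicator_of_mem (by simpa using hv) _
  have hlim : Tendsto (fun τ => ∫ v, F τ v ∂X.joint) atTop (𝓝 (∫ _, (0 : ℝ) ∂X.joint)) := by
    refine tendsto_integral_filter_of_dominated_convergence (fun v => |maxVal v|)
      (Eventually.of_forall hmeas) (Eventually.of_forall fun τ => Eventually.of_forall (hbound τ))
      X.integrable_maxVal.abs (Eventually.of_forall fun v => ?_)
    refine tendsto_const_nhds.congr' ?_
    filter_upwards [eventually_gt_atTop (maxVal v)] with τ hτ
    exact (Set.indicator_of_notMem (by simpa using hτ) _).symm
  have hne : ∀ τ, ∀ᵐ v ∂X.joint, maxVal v ≠ τ := by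
    intro τ
    have : ∀ᵐ v ∂X.joint, ∀ i, v i ≠ τ := ae_all_iff.2 fun i =>
      (X.measurePreserving_coord i).quasiMeasurePreserving.ae (p := fun x => x ≠ τ)
        (measure_eq_zero_iff_ae_notMem.1 (hX i τ))
    filter_upwards [this] with v hv
    obtain ⟨i, hi⟩ := exists_eq_maxVal v
    exact hi ▸ hv i
  have hcont : Continuous fun τ => ∫ v, F τ v ∂X.joint := by
    refine continuous_iff_continuousAt.2 fun τ => ?_
    refine continuousAt_of_dominated (bound := fun v => |maxVal v|) (Eventually.of_forall hmeas)
      (Eventually.of_forall fun τ => Eventually.of_forall (hbound τ)) X.integrable_maxVal.abs ?_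
    filter_upwards [hne τ] with v hv
    rcases lt_or_gt_of_ne hv with h | h
    · refine (continuousAt_const (y := (0 : ℝ))).congr ?_
      filter_upwards [lt_mem_nhds h] with σ hσ
      exact (Set.indicator_of_notMem (by simpa using hσ) _).symm
    · refine (continuousAt_const (y := maxVal v)).congr ?_
      filter_upwards [gt_mem_nhds h] with σ hσ
      exact (Set.indicator_of_mem (by simpa using hσ.le) _).symm
  rw [integral_zero] at hlim
  obtain ⟨T, hT, hT0⟩ := ((hlim.eventually_lt_const (mul_pos hc0 ho)).and
    (eventually_ge_atTop 0)).exists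
  obtain ⟨τ, hτ, h⟩ := intermediate_value_Icc' hT0 hcont.continuousOn
    ⟨hT.le, (mul_le_of_le_one_left ho.le hc1).trans_eq hF0.symm⟩
  exact ⟨τ, hτ.1, (hFint τ).trans h⟩

/-- When `OPT > 0`, `M` almost surely avoids `[τ, τ')`, and independence passes this on to every
entry; then both thresholds accept the same entries. -/
theorem tal_eq_of_le (X : ProphetInstance) {α τ τ' : ℝ} (hle : τ ≤ τ')
    (h : X.IsBaseThreshold (3 / 4) τ) (h' : X.IsBaseThreshold (3 / 4) τ') :
    X.tal α τ = X.tal α τ' := by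
  rcases X.opt_nonneg.eq_or_lt with ho | ho
  · rw [X.tal_eq_zero ho.symm h.1, X.tal_eq_zero ho.symm h'.1]
  have hτ := X.threshold_pos h ho
  have hq := X.probLt_pos h' ho
  -- the maximum avoids `[τ, τ')`
  have hM : ∀ᵐ v ∂X.joint, ¬ (τ ≤ maxVal v ∧ maxVal v < τ') := by
    have hmS : MeasurableSet {v : Fin X.n → ℝ | τ ≤ maxVal v ∧ maxVal v < τ'} :=
      (X.measurableSet_le_maxVal τ).inter (measurableSet_lt measurable_maxVal measurable_const)
    have hsplit : {v : Fin X.n → ℝ | τ ≤ maxVal v} =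
        {v | τ ≤ maxVal v ∧ maxVal v < τ'} ∪ {v | τ' ≤ maxVal v} := by
      ext v
      simp only [Set.mem_union, Set.mem_ofPred_eq]
      refine ⟨fun hv => ?_, ?_⟩
      · rcases lt_or_ge (maxVal v) τ' with h | h
        exacts [Or.inl ⟨hv, h⟩, Or.inr h]
      · rintro (hv | hv)
        exacts [hv.1, hle.trans hv]
    have hdisj : Disjoint {v : Fin X.n → ℝ | τ ≤ maxVal v ∧ maxVal v < τ'}
        {v | τ' ≤ maxVal v} :=
      Set.disjoint_left.2 fun v hv hv' => absurd hv.2 (not_lt.2 hv')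
    have h1 := h.2
    rw [hsplit, setIntegral_union hdisj (X.measurableSet_le_maxVal τ')
      X.integrable_maxVal.integrableOn X.integrable_maxVal.integrableOn, h'.2] at h1
    have h2 : ∫ v in {v : Fin X.n → ℝ | τ ≤ maxVal v ∧ maxVal v < τ'}, τ ∂X.joint ≤ 0 := by
      refine (setIntegral_mono_on (integrable_const _).integrableOn
        X.integrable_maxVal.integrableOn hmS fun v hv => hv.1).trans ?_
      linarith
    rw [setIntegral_const, smul_eq_mul] at h2
    have h3 : X.joint.real {v : Fin X.n → ℝ | τ ≤ maxVal v ∧ maxVal v < τ'} = 0 :=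
      le_antisymm (nonpos_of_mul_nonpos_left h2 hτ) measureReal_nonneg
    exact measure_eq_zero_iff_ae_notMem.1 ((measureReal_eq_zero_iff).1 h3)
  -- hence so does every entry
  have hlaw : ∀ i, X.law i (Set.Ico τ τ') = 0 := by
    intro i
    -- This box is null, and each of its sides `Iio τ'` has positive mass, so the side `Ico τ τ'`
    -- must be null.
    have hsub : (Set.univ.pi fun j => if j = i then Set.Ico τ τ' else Set.Iio τ') ⊆
        {v : Fin X.n → ℝ | τ ≤ maxVal v ∧ maxVal v < τ'} := by
      intro v hv
      have hi := hv i (Set.mem_univ i)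
      simp only [if_true] at hi
      refine ⟨hi.1.trans (le_maxVal v i), ?_⟩
      obtain ⟨j, hj⟩ := exists_eq_maxVal v
      rw [← hj]
      have := hv j (Set.mem_univ j)
      by_cases hji : j = i
      · rw [hji]; exact hi.2
      · simpa only [hji, if_false, Set.mem_Iio] using this
    have h0 := measure_mono_null hsub (measure_eq_zero_iff_ae_notMem.2 hM)
    rw [joint, Measure.pi_pi, Finset.prod_eq_zero_iff] at h0
    obtain ⟨j, -, hj⟩ := h0
    by_cases hji : j = i
    · subst hji; simpa using hj
    · rw [if_neg hji] at hj
      have := X.law_Iio_pos hq j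
      rw [measureReal_def, hj] at this
      simp at this
  have hall : ∀ᵐ v ∂X.joint, ∀ i, v i ∉ Set.Ico τ τ' := ae_all_iff.2 fun i =>
    (X.measurePreserving_coord i).quasiMeasurePreserving.ae (p := fun x => x ∉ Set.Ico τ τ')
      (measure_eq_zero_iff_ae_notMem.1 (hlaw i))
  refine integral_congr_ae ?_
  filter_upwards [hall] with v hv
  refine thresholdVal_congr fun i => ?_
  rw [max_le_iff, max_le_iff]
  exact and_congr_left fun _ => ⟨fun h => not_lt.1 fun h' => hv i ⟨h, h'⟩, hle.trans⟩

theorem tal_zero_le (X : ProphetInstance) {α τ : ℝ} (h1 : α ≤ 1) (hτ : 0 ≤ τ) :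
    X.tal 0 τ ≤ X.tal α τ := by
  refine integral_mono (X.integrable_talVal 0 τ) (X.integrable_talVal α τ) fun v => ?_
  have h : max τ (0 * maxVal v) = τ := by rw [zero_mul, max_eq_left hτ]
  simp only [h]
  rcases lt_or_ge (maxVal v) τ with hM | hM
  · rw [thresholdVal_eq_zero hM, thresholdVal_eq_zero (hM.trans_le (le_max_left _ _))]
  · obtain ⟨i, hi⟩ := exists_eq_maxVal v
    refine thresholdVal_mono (le_max_left _ _) ⟨i, ?_⟩
    rw [hi]
    exact max_le hM (mul_le_of_le_one_left (hτ.trans hM) h1)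

theorem tal_le (X : ProphetInstance) {α c τ : ℝ} (h : X.IsBaseThreshold c τ) :
    X.tal α τ ≤ c * X.opt := by
  rw [← h.2, ← integral_indicator (X.measurableSet_le_maxVal τ)]
  refine integral_mono_ae (X.integrable_talVal α τ)
    (X.integrable_maxVal.indicator (X.measurableSet_le_maxVal τ)) ?_
  filter_upwards [X.ae_maxVal_nonneg] with v hv
  rcases lt_or_ge (maxVal v) τ with hM | hM
  · rw [thresholdVal_eq_zero (hM.trans_le (le_max_left _ _)),
      Set.indicator_of_notMem (by simpa using hM)]
  · rw [Set.indicator_of_mem (by simpa using hM)]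
    exact thresholdVal_le_maxVal hv

end ProphetInstance

/-! ### Two-variable instances for the upper bound. -/

/-- The uniform distribution on `[a, b]`. -/
noncomputable def unifIcc (a b : ℝ) : Measure ℝ := ProbabilityTheory.cond volume (Set.Icc a b)

theorem isProbabilityMeasure_unifIcc {a b : ℝ} (h : a < b) : IsProbabilityMeasure (unifIcc a b) :=
  ProbabilityTheory.cond_isProbabilityMeasure_of_finite (by simpa using h) (by simp)

theorem ae_mem_unifIcc (a b : ℝ) : ∀ᵐ x ∂unifIcc a b, x ∈ Set.Icc a b :=
  ProbabilityTheory.ae_cond_mem measurableSet_Icc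

theorem unifIcc_singleton (a b x : ℝ) : unifIcc a b {x} = 0 :=
  ProbabilityTheory.cond_absolutelyContinuous (by simp)

theorem integrable_of_ae_mem_Icc {μ : Measure ℝ} [IsFiniteMeasure μ] {a b : ℝ}
    (h : ∀ᵐ x ∂μ, x ∈ Set.Icc a b) : Integrable (fun x : ℝ => x) μ :=
  Integrable.of_bound measurable_id.aestronglyMeasurable (max |a| |b|) <| by
    filter_upwards [h] with x hx using abs_le_max_abs_abs hx.1 hx.2

/-- The instance that consists of a first variable of law `μ` and a second one of law `ν`. -/
noncomputable def pairInstance (μ ν : Measure ℝ) [IsProbabilityMeasure μ] [IsProbabilityMeasure ν]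
    (hμ : ∀ᵐ x ∂μ, 0 ≤ x) (hν : ∀ᵐ x ∂ν, 0 ≤ x) (hμi : Integrable (fun x : ℝ => x) μ)
    (hνi : Integrable (fun x : ℝ => x) ν) : ProphetInstance where
  n := 2
  n_pos := two_pos
  law := ![μ, ν]
  isProb := Fin.forall_fin_two.2 ⟨‹_›, ‹_›⟩
  nonneg := Fin.forall_fin_two.2 ⟨hμ, hν⟩
  integrable := Fin.forall_fin_two.2 ⟨hμi, hνi⟩

theorem integral_pair_mul {μ ν : Measure ℝ} [IsProbabilityMeasure μ] [IsProbabilityMeasure ν]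
    (f g : ℝ → ℝ) :
    ∫ v : Fin 2 → ℝ, f (v 0) * g (v 1) ∂Measure.pi ![μ, ν] = (∫ x, f x ∂μ) * ∫ x, g x ∂ν := by
  have : ∀ i : Fin 2, IsProbabilityMeasure (![μ, ν] i) := Fin.forall_fin_two.2 ⟨‹_›, ‹_›⟩
  have := integral_fintype_prod_eq_prod (μ := ![μ, ν]) (𝕜 := ℝ) ![f, g]
  simpa [Fin.prod_univ_two] using this

theorem one_sub_real_Ici {ν : Measure ℝ} [IsProbabilityMeasure ν] (x : ℝ) :
    ν.real (Set.Iio x) = 1 - ν.real (Set.Ici x) := by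
  rw [← probReal_compl_eq_one_sub measurableSet_Ici, Set.compl_Ici]

/-- In an instance whose first entry lies in `[1 - ε, 1]` and whose second entry is at most `ε`
or, with probability `α / (1 + α)`, just below `N = (1 - ε) / α`, the algorithm with parameter `α`
accepts the first entry whenever it is at least the base threshold. -/
theorem pair_tal_mul_le {μ ν : Measure ℝ} [IsProbabilityMeasure μ] [IsProbabilityMeasure ν]
    {α ε N τ : ℝ} (hμ0 : ∀ᵐ x ∂μ, 0 ≤ x) (hν0 : ∀ᵐ x ∂ν, 0 ≤ x)
    (hμi : Integrable (fun x : ℝ => x) μ) (hνi : Integrable (fun x : ℝ => x) ν)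
    (hα0 : 0 < α) (hα1 : α < 1) (hε : 0 < ε) (hε1 : ε < 1 / 2) (hN : 1 ≤ N - ε)
    (hαN : α * N = 1 - ε) (hμ : ∀ᵐ x ∂μ, x ∈ Set.Icc (1 - ε) 1)
    (hν : ∀ᵐ x ∂ν, x ∈ Set.Icc 0 ε ∨ x ∈ Set.Icc (N - ε) N)
    (hr : ν.real (Set.Ici 1) = α / (1 + α))
    (h : (pairInstance μ ν hμ0 hν0 hμi hνi).IsBaseThreshold (3 / 4) τ) :
    (pairInstance μ ν hμ0 hν0 hμi hνi).tal α τ * (2 - 3 * ε) ≤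
      (1 + α / 2 + ε) * (pairInstance μ ν hμ0 hν0 hμi hνi).opt := by
  set X := pairInstance μ ν hμ0 hν0 hμi hνi with hX
  set r := ν.real (Set.Ici 1) with hr'
  set u := μ.real (Set.Iio τ) with hu
  have hsmall : ν.real (Set.Iio 1) = 1 - r := one_sub_real_Ici 1
  have hae : ∀ᵐ v ∂X.joint, v (0 : Fin 2) ∈ Set.Icc (1 - ε) 1 ∧
      (v (1 : Fin 2) ∈ Set.Icc 0 ε ∨ v (1 : Fin 2) ∈ Set.Icc (N - ε) N) := by
    have h0 := (X.measurePreserving_coord (0 : Fin 2)).quasiMeasurePreserving.ae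
      (p := fun x => x ∈ Set.Icc (1 - ε) 1) hμ
    have h1 := (X.measurePreserving_coord (1 : Fin 2)).quasiMeasurePreserving.ae
      (p := fun x => x ∈ Set.Icc 0 ε ∨ x ∈ Set.Icc (N - ε) N) hν
    filter_upwards [h0, h1] with v a b using ⟨a, b⟩
  have hprod : ∀ s t : Set ℝ, MeasurableSet s → MeasurableSet t →
      ∫ v, s.indicator 1 (v (0 : Fin 2)) * t.indicator (1 : ℝ → ℝ) (v (1 : Fin 2)) ∂X.joint =
        μ.real s * ν.real t := by
    intro s t hs ht
    rw [← integral_indicator_one hs, ← integral_indicator_one ht]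
    exact integral_pair_mul _ _
  have hint : ∀ s t : Set ℝ, MeasurableSet s → MeasurableSet t →
      Integrable (fun v => s.indicator 1 (v (0 : Fin 2)) * t.indicator (1 : ℝ → ℝ) (v (1 : Fin 2)))
        X.joint := by
    intro s t hs ht
    refine Integrable.of_bound ?_ 1 (Filter.Eventually.of_forall fun v => ?_)
    · exact (((measurable_one.indicator hs).comp (measurable_pi_apply (0 : Fin 2))).mul
        ((measurable_one.indicator ht).comp
          (measurable_pi_apply (1 : Fin 2)))).aestronglyMeasurable
    · by_cases h1 : v (0 : Fin 2) ∈ s <;> by_cases h2 : v (1 : Fin 2) ∈ t <;> simp [h1, h2]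
  have hopt : (1 - ε) * (1 - r) + (N - ε) * r ≤ X.opt := by
    have h1 := hprod Set.univ (Set.Iio 1) MeasurableSet.univ measurableSet_Iio
    have h2 := hprod Set.univ (Set.Ici 1) MeasurableSet.univ measurableSet_Ici
    rw [probReal_univ, one_mul] at h1 h2
    rw [← hsmall, hr', ← h1, ← h2, ← integral_const_mul, ← integral_const_mul, ← integral_add
      ((hint _ _ MeasurableSet.univ measurableSet_Iio).const_mul _)
      ((hint _ _ MeasurableSet.univ measurableSet_Ici).const_mul _)]
    refine integral_mono_ae (((hint _ _ MeasurableSet.univ measurableSet_Iio).const_mul _).add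
      ((hint _ _ MeasurableSet.univ measurableSet_Ici).const_mul _)) X.integrable_maxVal ?_
    filter_upwards [hae] with v ⟨hv0, hv1⟩
    rcases lt_or_ge (v (1 : Fin 2)) 1 with hs | hs
    · have := hv0.1.trans (le_maxVal v (0 : Fin 2))
      simpa [hs, hs.not_ge] using this
    · rcases hv1 with hv1 | hv1
      · linarith [hv1.2]
      · have := hv1.1.trans (le_maxVal v (1 : Fin 2))
        simpa [hs, hs.not_gt] using this
  have hmax : ∀ v : Fin X.n → ℝ, ∀ c, v (0 : Fin 2) ≤ c → v (1 : Fin 2) ≤ c → maxVal v ≤ c := by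
    intro v c h0 h1
    obtain ⟨i, hi⟩ := exists_eq_maxVal v
    rw [← hi]
    exact (Fin.forall_fin_two.2 ⟨h0, h1⟩ : ∀ i : Fin 2, v i ≤ c) i
  -- An accepted first entry pays at most `1`. A rejected one leaves at most `N`, and only if the
  -- second entry is large.
  have htal : X.tal α τ ≤ 1 - u * (1 - N * r) := by
    have h1 := hprod (Set.Iio τ) Set.univ measurableSet_Iio MeasurableSet.univ
    have h2 := hprod (Set.Iio τ) (Set.Ici 1) measurableSet_Iio measurableSet_Ici
    have i1 := hint (Set.Iio τ) Set.univ measurableSet_Iio MeasurableSet.univ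
    have i2 := hint (Set.Iio τ) (Set.Ici 1) measurableSet_Iio measurableSet_Ici
    rw [probReal_univ, mul_one] at h1
    have h3 : 1 - u * (1 - N * r) = ∫ v, (1 -
        (Set.Iio τ).indicator 1 (v (0 : Fin 2)) *
          (Set.univ : Set ℝ).indicator (1 : ℝ → ℝ) (v (1 : Fin 2)) +
        N * ((Set.Iio τ).indicator 1 (v (0 : Fin 2)) *
          (Set.Ici 1).indicator (1 : ℝ → ℝ) (v (1 : Fin 2)))) ∂X.joint := by
      have ic : Integrable (fun v => 1 - (Set.Iio τ).indicator 1 (v (0 : Fin 2)) *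
          (Set.univ : Set ℝ).indicator (1 : ℝ → ℝ) (v (1 : Fin 2))) X.joint :=
        (integrable_const _).sub i1
      rw [integral_add ic (i2.const_mul N),
        integral_sub (integrable_const _) i1, integral_const_mul, h1, h2]
      simp
      ring
    rw [h3]
    refine integral_mono_ae (X.integrable_talVal α τ)
      (((integrable_const _).sub i1).add (i2.const_mul N)) ?_
    filter_upwards [hae] with v ⟨hv0, hv1⟩
    have hv1N : v (1 : Fin 2) ≤ N := by rcases hv1 with hv1 | hv1 <;> linarith [hv1.2]
    have hMN : maxVal v ≤ N := hmax v N (by linarith [hv0.2]) hv1N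
    have hM0 : 0 ≤ maxVal v := by linarith [hv0.1, le_maxVal v (0 : Fin 2)]
    rcases lt_or_ge (v (0 : Fin 2)) τ with hτ | hτ
    · rcases lt_or_ge (v (1 : Fin 2)) 1 with hs | hs
      · have hv1s : v (1 : Fin 2) ≤ ε := by
          rcases hv1 with hv1 | hv1 <;> linarith [hv1.1, hv1.2]
        have hMτ : maxVal v < τ := (hmax v _ le_rfl (by linarith [hv0.1])).trans_lt hτ
        rw [thresholdVal_eq_zero (hMτ.trans_le (le_max_left _ _))]
        simp [hτ, hs.not_ge]
      · have := (thresholdVal_le_maxVal (ζ := max τ (α * maxVal v)) hM0).trans hMN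
        simpa [hτ, hs] using this
    · have hle : max τ (α * maxVal v) ≤ v (0 : Fin 2) :=
        max_le hτ (((mul_le_mul_of_nonneg_left hMN hα0.le).trans_eq hαN).trans hv0.1)
      refine (thresholdVal_of_first (n := 2) (i := 0) hle fun j hj =>
        absurd hj (Nat.not_lt_zero j.val)).le.trans ?_
      simpa [hτ.not_gt] using hv0.2
  have hu1 : u ≤ 1 := measureReal_le_one
  have hu0 : 0 ≤ u := measureReal_nonneg
  -- For `τ ≤ 1`, the event `M < τ` needs a rejected first and a small second entry, and there `M ≤
  -- 1`.
  have hub : u = 1 ∨ X.opt / 4 ≤ u * (1 - r) := by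
    rcases lt_or_ge 1 τ with hτ | hτ
    · left
      have : ∀ᵐ x ∂μ, x ∈ Set.Iio τ := by
        filter_upwards [hμ] with x hx using hx.2.trans_lt hτ
      rw [hu, measureReal_def, (mem_ae_iff_prob_eq_one measurableSet_Iio).1 this]
      simp
    · right
      rw [← X.setIntegral_lt_eq h, ← hsmall, hu,
        ← hprod _ _ measurableSet_Iio measurableSet_Iio, ← integral_indicator
          (measurableSet_lt measurable_maxVal measurable_const)]
      refine integral_mono_ae (X.integrable_maxVal.indicator
        (measurableSet_lt measurable_maxVal measurable_const))
        (hint _ _ measurableSet_Iio measurableSet_Iio) ?_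
      filter_upwards [hae] with v ⟨hv0, hv1⟩
      by_cases hM : maxVal v < τ
      · have h0 := (le_maxVal v (0 : Fin 2)).trans_lt hM
        have h1 := ((le_maxVal v (1 : Fin 2)).trans_lt hM).trans_le hτ
        simpa [hM, h0, h1] using hM.le.trans hτ
      · rw [Set.indicator_of_notMem (by simpa using hM)]
        exact mul_nonneg (Set.indicator_nonneg (fun _ _ => zero_le_one) _)
          (Set.indicator_nonneg (fun _ _ => zero_le_one) _)
  have h1α : 0 < 1 + α := by linarith
  obtain ⟨w, hw⟩ : ∃ w, w * (1 + α) = 1 := ⟨(1 + α)⁻¹, inv_mul_cancel₀ h1α.ne'⟩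
  have hw0 : 0 < w := pos_of_mul_pos_left (one_pos.trans_eq hw.symm) h1α.le
  have hrw : r = α * w := by rw [hr, div_eq_iff h1α.ne', mul_assoc, hw, mul_one]
  have hrw' : 1 - r = w := by rw [hrw]; linarith
  -- The choice `r = α / (1 + α)` makes small and large second entries contribute about equally to
  -- `OPT ≈ 2 w`, hence `u` is at least about `1/2`.
  have hNr : N * r = (1 - ε) * w := by rw [hrw, ← hαN]; ring
  have hopt' : (2 - 3 * ε) * w ≤ X.opt := by
    rw [hrw', sub_mul N, hNr, hrw] at hopt
    linarith [mul_nonneg (mul_nonneg hε.le hw0.le) (sub_nonneg.2 hα1.le)]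
  have hu2 : 2 - 3 * ε ≤ 4 * u := by
    rcases hub with hub | hub
    · linarith
    · rw [hrw'] at hub
      have : (2 - 3 * ε) * w ≤ (4 * u) * w := by linarith
      exact le_of_mul_le_mul_right this hw0
  have htal' : X.tal α τ ≤ (1 + α / 2 + ε) * w := by
    rw [hNr] at htal
    have h4 : 1 - u * (1 - (1 - ε) * w) = (1 + α - u * (α + ε)) * w := by
      linear_combination (u - 1) * hw
    rw [h4] at htal
    refine htal.trans (mul_le_mul_of_nonneg_right ?_ hw0.le)
    nlinarith
  calc X.tal α τ * (2 - 3 * ε) ≤ (1 + α / 2 + ε) * w * (2 - 3 * ε) :=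
        mul_le_mul_of_nonneg_right htal' (by linarith)
    _ = (1 + α / 2 + ε) * ((2 - 3 * ε) * w) := by ring
    _ ≤ _ := mul_le_mul_of_nonneg_left hopt' (by positivity)

/-- There are continuous instances on which the ratio comes close to `1 / 2 + α / 4`. -/
theorem exists_tal_div_opt_le {α ε : ℝ} (hα0 : 0 < α) (hα1 : α < 1) (hε : 0 < ε)
    (hεα : ε ≤ (1 - α) / 2) : ∃ (X : ProphetInstance) (τ : ℝ), X.IsContinuous ∧
      X.IsBaseThreshold (3 / 4) τ ∧ X.tal α τ / X.opt ≤ (1 + α / 2 + ε) / (2 - 3 * ε) := by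
  obtain ⟨N, hN⟩ : ∃ N, α * N = 1 - ε := ⟨(1 - ε) / α, mul_div_cancel₀ _ hα0.ne'⟩
  -- Multiplied by `α` this is `ε (1 + α) ≤ 1 - α`, which `ε ≤ (1 - α) / 2` ensures.
  have hN1 : 1 ≤ N - ε := by
    refine le_of_mul_le_mul_left (?_ : α * 1 ≤ α * (N - ε)) hα0
    nlinarith
  have hr0 : 0 ≤ α / (1 + α) := by positivity
  have hr1 : 0 ≤ 1 / (1 + α) := by positivity
  have hsum : 1 / (1 + α) + α / (1 + α) = 1 := by field_simp
  have h1 : IsProbabilityMeasure (unifIcc (1 - ε) 1) := isProbabilityMeasure_unifIcc (by linarith)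
  have h2 : IsProbabilityMeasure (unifIcc 0 ε) := isProbabilityMeasure_unifIcc hε
  have h3 : IsProbabilityMeasure (unifIcc (N - ε) N) :=
    isProbabilityMeasure_unifIcc (by linarith)
  set ν : Measure ℝ := ENNReal.ofReal (1 / (1 + α)) • unifIcc 0 ε +
    ENNReal.ofReal (α / (1 + α)) • unifIcc (N - ε) N with hνdef
  have hνp : IsProbabilityMeasure ν := ⟨by
    simp [hνdef, -one_div, ← ENNReal.ofReal_add hr1 hr0, hsum]⟩
  have hν : ∀ᵐ x ∂ν, x ∈ Set.Icc 0 ε ∨ x ∈ Set.Icc (N - ε) N := by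
    rw [hνdef, ae_add_measure_iff]
    exact ⟨Measure.ae_smul_measure ((ae_mem_unifIcc _ _).mono fun x hx => Or.inl hx) _,
      Measure.ae_smul_measure ((ae_mem_unifIcc _ _).mono fun x hx => Or.inr hx) _⟩
  have hμ := ae_mem_unifIcc (1 - ε) 1
  have hμ0 : ∀ᵐ x ∂unifIcc (1 - ε) 1, 0 ≤ x := by
    filter_upwards [hμ] with x hx
    linarith [hx.1]
  have hνN : ∀ᵐ x ∂ν, x ∈ Set.Icc 0 N := by
    filter_upwards [hν] with x hx
    rcases hx with hx | hx <;> exact ⟨by linarith [hx.1], by linarith [hx.2]⟩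
  have hr : ν.real (Set.Ici 1) = α / (1 + α) := by
    have e1 : unifIcc 0 ε (Set.Ici 1) = 0 := by
      refine measure_eq_zero_iff_ae_notMem.2 ?_
      filter_upwards [ae_mem_unifIcc 0 ε] with x hx hx1
      have : (1 : ℝ) ≤ x := hx1
      linarith [hx.2]
    have e2 : unifIcc (N - ε) N (Set.Ici 1) = 1 := by
      refine (mem_ae_iff_prob_eq_one measurableSet_Ici).1 ?_
      filter_upwards [ae_mem_unifIcc (N - ε) N] with x hx using hN1.trans hx.1
    simp [measureReal_def, hνdef, e1, e2, hr0]
  have hcont : (pairInstance (unifIcc (1 - ε) 1) ν hμ0 (hνN.mono fun x hx => hx.1)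
      (integrable_of_ae_mem_Icc hμ) (integrable_of_ae_mem_Icc hνN)).IsContinuous := by
    refine Fin.forall_fin_two.2 ⟨fun x => unifIcc_singleton _ _ x, fun x => ?_⟩
    change ν {x} = 0
    simp [hνdef, unifIcc_singleton]
  obtain ⟨τ, hτ⟩ := ProphetInstance.exists_isBaseThreshold _ hcont (c := 3 / 4) (by norm_num)
    (by norm_num)
  refine ⟨_, τ, hcont, hτ, ?_⟩
  rw [div_le_div_iff₀ (ProphetInstance.opt_pos_of_isContinuous _ hcont) (by linarith)]
  exact pair_tal_mul_le _ _ _ _ hα0 hα1 hε (by linarith) hN1 hN hμ hν hr hτ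

/-! ### Bounds on the competitive ratio. -/

theorem le_obliviousRatio {α c : ℝ} (hc : ∀ (X : ProphetInstance) (τ : ℝ), X.IsContinuous →
    X.IsBaseThreshold (3 / 4) τ → c * X.opt ≤ X.tal α τ) : c ≤ obliviousRatio α := by
  refine le_csInf ?_ ?_
  -- Any admissible parameters do: only nonemptiness matters, because `sInf ∅ = 0` in `ℝ`.
  · obtain ⟨X, τ, hX, hτ, -⟩ := exists_tal_div_opt_le (α := 1 / 2) (ε := 1 / 4) (by norm_num)
      (by norm_num) (by norm_num) (by norm_num)
    exact ⟨_, X, τ, hX, hτ, rfl⟩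
  · rintro _ ⟨X, τ, hX, hτ, rfl⟩
    exact (le_div_iff₀ (X.opt_pos_of_isContinuous hX)).2 (hc X τ hX hτ)

theorem obliviousRatio_le {α : ℝ} {X : ProphetInstance} {τ : ℝ} (hX : X.IsContinuous)
    (hτ : X.IsBaseThreshold (3 / 4) τ) : obliviousRatio α ≤ X.tal α τ / X.opt := by
  refine csInf_le ⟨0, ?_⟩ ⟨X, τ, hX, hτ, rfl⟩
  rintro _ ⟨Y, σ, -, hσ, rfl⟩
  exact div_nonneg (Y.tal_nonneg hσ.1) Y.opt_nonneg

open Filter Topology in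
theorem obliviousRatio_le_of_mem_Ioo {α : ℝ} (hα0 : 0 < α) (hα1 : α < 1) :
    obliviousRatio α ≤ 1 / 2 + α / 4 := by
  have hlim : Tendsto (fun ε : ℝ => (1 + α / 2 + ε) / (2 - 3 * ε)) (𝓝[>] 0)
      (𝓝 ((1 + α / 2 + 0) / (2 - 3 * 0))) := by
    refine ContinuousAt.tendsto (f := fun ε : ℝ => (1 + α / 2 + ε) / (2 - 3 * ε)) ?_
      |>.mono_left nhdsWithin_le_nhds
    exact ContinuousAt.div (by fun_prop) (by fun_prop) (by norm_num)
  have heq : (1 + α / 2 + 0) / (2 - 3 * 0) = 1 / 2 + α / 4 := by ring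
  rw [heq] at hlim
  refine ge_of_tendsto hlim ?_
  filter_upwards [Ioc_mem_nhdsGT (show (0 : ℝ) < (1 - α) / 2 by linarith)] with ε hε
  obtain ⟨X, τ, hX, hτ, h⟩ := exists_tal_div_opt_le hα0 hα1 hε.1 hε.2
  exact (obliviousRatio_le hX hτ).trans h

theorem obliviousRatio_zero_le {α : ℝ} (h1 : α ≤ 1) :
    obliviousRatio 0 ≤ obliviousRatio α := by
  refine le_obliviousRatio fun X τ hX hτ => ?_
  have ho := X.opt_pos_of_isContinuous hX
  exact ((le_div_iff₀ ho).1 (obliviousRatio_le hX hτ)).trans (X.tal_zero_le h1 hτ.1)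

theorem obliviousRatio_zero : obliviousRatio 0 = 1 / 2 := by
  refine le_antisymm (le_of_forall_pos_le_add fun δ hδ => ?_) (le_obliviousRatio fun X τ _ hτ => ?_)
  -- The hard instances need `α > 0`, so `0` is approached through small `α` by monotonicity; `1 /
  -- 2` keeps `α < 1`.
  · set α := min δ (1 / 2) with hα
    have hα0 : 0 < α := lt_min hδ (by norm_num)
    have hα1 : α ≤ 1 / 2 := min_le_right _ _
    have hαδ : α ≤ δ := min_le_left _ _
    linarith [obliviousRatio_zero_le (by linarith : α ≤ 1),
      obliviousRatio_le_of_mem_Ioo hα0 (by linarith)]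
  · simpa using X.tal_ge le_rfl zero_le_one hτ

theorem obliviousRatio_one : obliviousRatio 1 = 3 / 4 := by
  refine le_antisymm ?_ (le_obliviousRatio fun X τ _ hτ => ?_)
  · obtain ⟨X, τ, hX, hτ, -⟩ := exists_tal_div_opt_le (α := 1 / 2) (ε := 1 / 4) (by norm_num)
      (by norm_num) (by norm_num) (by norm_num)
    exact (obliviousRatio_le hX hτ).trans
      ((div_le_iff₀ (X.opt_pos_of_isContinuous hX)).2 (X.tal_le hτ))
  · have := X.tal_ge zero_le_one le_rfl hτ
    norm_num at this ⊢
    exact this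

theorem theorem4p2 :
    -- the base threshold exists for continuous variables
    (∀ X : ProphetInstance, X.IsContinuous → ∃ τ : ℝ, X.IsBaseThreshold (3 / 4) τ) ∧
    -- the expected value of the algorithm does not depend on which solution is taken
    (∀ α ∈ Set.Icc (0 : ℝ) 1, ∀ (X : ProphetInstance) (τ τ' : ℝ),
      X.IsBaseThreshold (3 / 4) τ → X.IsBaseThreshold (3 / 4) τ' → X.tal α τ = X.tal α τ') ∧
    -- the guarantee on each instance (continuous or not)
    (∀ α ∈ Set.Icc (0 : ℝ) 1, ∀ (X : ProphetInstance) (τ : ℝ),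
      X.IsBaseThreshold (3 / 4) τ → (1 / 2 + α ^ 3 / 4) * X.opt ≤ X.tal α τ) ∧
    -- the bounds on the competitive ratio
    (∀ α ∈ Set.Icc (0 : ℝ) 1,
      1 / 2 + α ^ 3 / 4 ≤ obliviousRatio α ∧ obliviousRatio α ≤ 1 / 2 + α / 4) ∧
    obliviousRatio 0 = 1 / 2 ∧ obliviousRatio 1 = 3 / 4 := by
  have hge : ∀ α ∈ Set.Icc (0 : ℝ) 1, ∀ (X : ProphetInstance) (τ : ℝ),
      X.IsBaseThreshold (3 / 4) τ → (1 / 2 + α ^ 3 / 4) * X.opt ≤ X.tal α τ :=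
    fun α hα X τ hτ => X.tal_ge hα.1 hα.2 hτ
  refine ⟨fun X hX => X.exists_isBaseThreshold hX (by norm_num) (by norm_num),
    fun α _ X τ τ' h h' => ?_, hge, fun α hα => ⟨le_obliviousRatio fun X τ _ => hge α hα X τ, ?_⟩,
    obliviousRatio_zero, obliviousRatio_one⟩
  · rcases le_total τ τ' with hle | hle
    exacts [X.tal_eq_of_le hle h h', (X.tal_eq_of_le hle h' h).symm]
  · rcases hα.1.eq_or_lt with rfl | h0
    · rw [obliviousRatio_zero]; norm_num
    rcases hα.2.eq_or_lt with rfl | h1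
    · rw [obliviousRatio_one]; norm_num
    exact obliviousRatio_le_of_mem_Ioo h0 h1
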